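/- Let $S\in\{\tfrac12,1,\tfrac32,\dots\}$ and $\beta\in\mathbb R$. For $n\ge1$ let $S_i^{(1)},S_i^{(2)},S_i^{(3)}$ be the usual spin-$S$ operators acting at site $i$ on $(\mathbb C^{2S+1})^{\otimes n}$ (so that $[S_j^{(1)},S_k^{(2)}]=\mathrm i\,\delta_{jk}S_j^{(3)}$ and cyclically, and $\sum_{a}(S_j^{(a)})^2=S(S+1)\mathbf 1$). Let $$H_n=-\frac2n\sum_{1\le i<j\le n}\bigl(S_i^{(1)}S_j^{(1)}+S_i^{(2)}S_j^{(2)}+S_i^{(3)}S_j^{(3)}\bigr)$$ be the Hamiltonian of the isotropic ($\Delta=1$) Heisenberg model on the complete graph, and let $\langle A\rangle_{n,\beta}=\operatorname{Tr}[A\,e^{-\beta H_n}]/\operatorname{Tr}[e^{-\beta H_n}]$. Define $$\eta(x)=\log\frac{\sinh(\frac{2S+1}2x)}{\sinh(\frac12x)}\quad(x\in\mathbb R,\ x\ne0),\qquad \eta(0)=\log(2S+1).$$ Then for every $m\in(-S,S)$ the equation $\eta'(x)=m$ has a unique solution $x^\star(m)\in\mathbb R$, and the function $$g_\beta(m)=\eta(x^\star(m))-m\,x^\star(m)+\beta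 m^2,\qquad m\in[0,S),$$ has a unique maximiser $m^\star(\beta)\in[0,S)$. One has $m^\star(\beta)>0$ if and only if $\beta>\beta_{\mathrm c}=\dfrac{3/2}{S^2+S}$. Moreover, for every $h\in\mathbb C$, $$\lim_{n\to\infty}\Bigl\langle\exp\Bigl\{\frac hn\sum_{i=1}^nS_i^{(1)}\Bigr\}\Bigr\rangle_{n,\beta}=\frac{\sinh(h\,m^\star(\beta))}{h\,m^\star(\beta)},$$ where the right-hand side is read as $1$ if $h\,m^\star(\beta)=0$. -/

import Mathlib

noncomputable section

namespace SpinSystem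

/-! The parameter `N : ℕ` stands for `2S`, so that `S = N / 2` and one site has state space
`ℂ ^ (N + 1)`.  The space `(ℂ ^ (N + 1)) ^ ⊗ n` is written in its standard product basis, which is
indexed by the configurations `Fin n → Fin (N + 1)`; operators are matrices in that basis. -/

/-- The spin quantum number `S = N / 2`. -/
def spin (N : ℕ) : ℝ := N / 2

/-- The eigenvalue `-S + a` of the third spin operator on the basis vector `a`. -/
def weight (N : ℕ) (a : Fin (N + 1)) : ℝ := (a : ℝ) - spin N

/-- The raising operator: `S⁺ |m⟩ = √(S (S + 1) - m (m + 1)) |m + 1⟩`. -/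
def raising (N : ℕ) : Matrix (Fin (N + 1)) (Fin (N + 1)) ℂ :=
  Matrix.of fun a b =>
    if (a : ℕ) = (b : ℕ) + 1 then
      ((Real.sqrt (spin N * (spin N + 1) - weight N b * (weight N b + 1)) : ℝ) : ℂ)
    else 0

/-- The first spin operator `(S⁺ + S⁻) / 2` of one site. -/
def spin1 (N : ℕ) : Matrix (Fin (N + 1)) (Fin (N + 1)) ℂ :=
  (1 / 2 : ℂ) • (raising N + (raising N).conjTranspose)

/-- The second spin operator `(S⁺ - S⁻) / (2i)` of one site. -/
def spin2 (N : ℕ) : Matrix (Fin (N + 1)) (Fin (N + 1)) ℂ :=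
  (1 / (2 * Complex.I) : ℂ) • (raising N - (raising N).conjTranspose)

/-- The third spin operator of one site. -/
def spin3 (N : ℕ) : Matrix (Fin (N + 1)) (Fin (N + 1)) ℂ :=
  Matrix.diagonal fun a => ((weight N a : ℝ) : ℂ)

/-- Operators on `n` sites. -/
abbrev Op (N n : ℕ) : Type := Matrix (Fin n → Fin (N + 1)) (Fin n → Fin (N + 1)) ℂ

open Classical in
/-- The operator `1 ⊗ ⋯ ⊗ A ⊗ ⋯ ⊗ 1` with `A` acting at site `i`. -/
def atSite {N n : ℕ} (A : Matrix (Fin (N + 1)) (Fin (N + 1)) ℂ) (i : Fin n) : Op N n :=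
  Matrix.of fun σ τ => if ∀ j, j ≠ i → σ j = τ j then A (σ i) (τ i) else 0

/-- The Heisenberg Hamiltonian on the complete graph with `n` vertices,
`-(2/n) ∑_{i < j} (S_i¹ S_j¹ + S_i² S_j² + Δ S_i³ S_j³)`. -/
def heisenberg (N n : ℕ) (Δ : ℝ) : Op N n :=
  (-(2 / (n : ℂ))) • ∑ i : Fin n, ∑ j ∈ Finset.univ.filter (fun j : Fin n => i < j),
    (atSite (spin1 N) i * atSite (spin1 N) j + atSite (spin2 N) i * atSite (spin2 N) j
      + (Δ : ℂ) • (atSite (spin3 N) i * atSite (spin3 N) j))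

/-- The Gibbs state `⟨A⟩ = Tr (A e^{-βH}) / Tr (e^{-βH})` of the Heisenberg model. -/
def gibbs (N n : ℕ) (β Δ : ℝ) (A : Op N n) : ℂ :=
  (A * NormedSpace.exp ((-(β : ℂ)) • heisenberg N n Δ)).trace /
    (NormedSpace.exp ((-(β : ℂ)) • heisenberg N n Δ)).trace

/-- `η(x) = log (sinh ((2S + 1) x / 2) / sinh (x / 2))`, with `η(0) = log (2S + 1)`. -/
def eta (N : ℕ) (x : ℝ) : ℝ :=
  if x = 0 then Real.log (2 * spin N + 1)
  else Real.log (Real.sinh ((2 * spin N + 1) / 2 * x) / Real.sinh (1 / 2 * x))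

/-- `x⋆(m)`, the solution `x` of `η'(x) = m`. -/
def xStar (N : ℕ) (m : ℝ) : ℝ := Classical.epsilon fun x : ℝ => HasDerivAt (eta N) m x

/-- `g_β(m) = η(x⋆(m)) - m x⋆(m) + β m²`. -/
def gFun (N : ℕ) (β m : ℝ) : ℝ := eta N (xStar N m) - m * xStar N m + β * m ^ 2

/-- `m` is a maximiser of `g_β` on `[0, S)`. -/
def IsMaximiser (N : ℕ) (β m : ℝ) : Prop :=
  m ∈ Set.Ico 0 (spin N) ∧ IsMaxOn (gFun N β) (Set.Ico 0 (spin N)) m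

/-- `m⋆(β)`, the maximiser of `g_β` on `[0, S)`. -/
def mStar (N : ℕ) (β : ℝ) : ℝ := Classical.epsilon (IsMaximiser N β)

/-- The critical inverse temperature `(3/2) / (S² + S)`. -/
def betaC (N : ℕ) : ℝ := (3 / 2) / (spin N ^ 2 + spin N)

/-- The entire function `sinh z / z`, with value `1` at `0`. -/
def sinhc (z : ℂ) : ℂ := if z = 0 then 1 else Complex.sinh z / z

end SpinSystem

end

noncomputable section

namespace SpinSystem

/-- The exponential moments `∑ₐ wₐ ^ k e ^ (x wₐ)` of the spectrum of the third spin operator. -/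
def expMoment (N k : ℕ) (x : ℝ) : ℝ := ∑ a, weight N a ^ k * Real.exp (x * weight N a)

/-- The derivative of `eta`: the mean weight under exponential tilting by `x`. -/
def etaDeriv (N : ℕ) (x : ℝ) : ℝ := expMoment N 1 x / expMoment N 0 x

theorem spin_nonneg (N : ℕ) : 0 ≤ spin N := by unfold spin; positivity

theorem spin_pos {N : ℕ} (hN : 1 ≤ N) : 0 < spin N := by
  have : (0 : ℝ) < N := by exact_mod_cast hN
  unfold spin; positivity

theorem weight_le_spin (N : ℕ) (a : Fin (N + 1)) : weight N a ≤ spin N := by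
  have : ((a : ℕ) : ℝ) ≤ N := by exact_mod_cast Nat.lt_succ_iff.1 a.2
  unfold weight spin; linarith

theorem neg_spin_le_weight (N : ℕ) (a : Fin (N + 1)) : -spin N ≤ weight N a := by
  have : (0 : ℝ) ≤ ((a : ℕ) : ℝ) := by positivity
  unfold weight; linarith

theorem weight_last (N : ℕ) : weight N (Fin.last N) = spin N := by
  simp [weight, spin]; ring

theorem weight_zero (N : ℕ) : weight N 0 = -spin N := by simp [weight]

theorem weight_rev (N : ℕ) (a : Fin (N + 1)) : weight N a.rev = -weight N a := by
  have h : (a : ℕ) ≤ N := Nat.lt_succ_iff.1 a.2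
  simp only [weight, spin, Fin.val_rev]
  rw [show N + 1 - ((a : ℕ) + 1) = N - a by omega, Nat.cast_sub h]
  ring

theorem expMoment_neg (N k : ℕ) (x : ℝ) : expMoment N k (-x) = (-1) ^ k * expMoment N k x := by
  unfold expMoment
  rw [← Equiv.sum_comp Fin.revPerm, Finset.mul_sum]
  refine Finset.sum_congr rfl fun a _ => ?_
  rw [Fin.revPerm_apply, weight_rev, neg_mul_neg, neg_pow, mul_assoc]

theorem expMoment_zero_pos (N : ℕ) (x : ℝ) : 0 < expMoment N 0 x := by
  unfold expMoment
  refine Finset.sum_pos (fun a _ => ?_) Finset.univ_nonempty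
  positivity

theorem hasDerivAt_expMoment (N k : ℕ) (x : ℝ) :
    HasDerivAt (expMoment N k) (expMoment N (k + 1) x) x := by
  unfold expMoment
  refine HasDerivAt.fun_sum fun a _ => ?_
  have h := (((hasDerivAt_id x).mul_const (weight N a)).exp).const_mul (weight N a ^ k)
  refine h.congr_deriv ?_
  simp only [id, one_mul]; ring

theorem expMoment_zero_mul_sinh (N : ℕ) (x : ℝ) :
    expMoment N 0 x * Real.sinh (1 / 2 * x) = Real.sinh ((2 * spin N + 1) / 2 * x) := by
  have h : ∑ a ∈ Finset.range (N + 1),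
      (Real.exp (x * ((a + 1 : ℕ) - spin N - 1 / 2)) - Real.exp (x * ((a : ℕ) - spin N - 1 / 2)))
      = Real.exp (x * ((N + 1 : ℕ) - spin N - 1 / 2)) - Real.exp (x * ((0 : ℕ) - spin N - 1 / 2)) :=
    Finset.sum_range_sub (fun a : ℕ => Real.exp (x * ((a : ℝ) - spin N - 1 / 2))) (N + 1)
  rw [← Fin.sum_univ_eq_sum_range (fun a : ℕ => Real.exp (x * ((a + 1 : ℕ) - spin N - 1 / 2))
    - Real.exp (x * ((a : ℕ) - spin N - 1 / 2)))] at h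
  have h2 : expMoment N 0 x * (2 * Real.sinh (1 / 2 * x)) =
      ∑ a : Fin (N + 1), (Real.exp (x * (((a : ℕ) + 1 : ℕ) - spin N - 1 / 2))
        - Real.exp (x * ((a : ℕ) - spin N - 1 / 2))) := by
    unfold expMoment
    rw [Finset.sum_mul]
    refine Finset.sum_congr rfl fun a _ => ?_
    rw [Real.sinh_eq, pow_zero, one_mul, mul_div_cancel₀ _ two_ne_zero, mul_sub, ← Real.exp_add,
      ← Real.exp_add]
    unfold weight
    push_cast
    ring_nf
  rw [h] at h2
  have h3 : 2 * Real.sinh ((2 * spin N + 1) / 2 * x) = Real.exp (x * ((N + 1 : ℕ) - spin N - 1 / 2))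
      - Real.exp (x * ((0 : ℕ) - spin N - 1 / 2)) := by
    rw [Real.sinh_eq, mul_div_cancel₀ _ two_ne_zero]
    unfold spin
    push_cast
    ring_nf
  linarith

theorem eta_eq_log (N : ℕ) (x : ℝ) : eta N x = Real.log (expMoment N 0 x) := by
  unfold eta
  split_ifs with h
  · subst h; simp [expMoment, spin]; ring_nf
  · have hs : Real.sinh (1 / 2 * x) ≠ 0 := by
      rw [Ne, Real.sinh_eq_zero]; simpa using h
    rw [← expMoment_zero_mul_sinh, mul_div_cancel_right₀ _ hs]

theorem exp_eta (N : ℕ) (x : ℝ) : Real.exp (eta N x) = expMoment N 0 x := by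
  rw [eta_eq_log, Real.exp_log (expMoment_zero_pos N x)]

theorem eta_neg (N : ℕ) (x : ℝ) : eta N (-x) = eta N x := by
  rw [eta_eq_log, eta_eq_log, expMoment_neg]; simp

theorem etaDeriv_neg (N : ℕ) (x : ℝ) : etaDeriv N (-x) = -etaDeriv N x := by
  unfold etaDeriv
  rw [expMoment_neg, expMoment_neg]; simp [neg_div]

theorem etaDeriv_zero (N : ℕ) : etaDeriv N 0 = 0 := by
  have := etaDeriv_neg N 0
  rw [neg_zero] at this; linarith

theorem hasDerivAt_eta (N : ℕ) (x : ℝ) : HasDerivAt (eta N) (etaDeriv N x) x := by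
  have h := (hasDerivAt_expMoment N 0 x).log (expMoment_zero_pos N x).ne'
  exact h.congr_of_eventuallyEq (Filter.Eventually.of_forall (eta_eq_log N))

theorem hasDerivAt_eta_iff {N : ℕ} {m x : ℝ} : HasDerivAt (eta N) m x ↔ etaDeriv N x = m :=
  ⟨fun h => (hasDerivAt_eta N x).unique h, fun h => h ▸ hasDerivAt_eta N x⟩

theorem hasDerivAt_etaDeriv (N : ℕ) (x : ℝ) :
    HasDerivAt (etaDeriv N) ((expMoment N 2 x * expMoment N 0 x - expMoment N 1 x ^ 2) /
      expMoment N 0 x ^ 2) x := by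
  have h := (hasDerivAt_expMoment N 1 x).div (hasDerivAt_expMoment N 0 x)
    (expMoment_zero_pos N x).ne'
  refine h.congr_deriv ?_
  rw [sq (expMoment N 1 x)]

theorem expMoment_one_sq_lt {N : ℕ} (hN : 1 ≤ N) (x : ℝ) :
    expMoment N 1 x ^ 2 < expMoment N 2 x * expMoment N 0 x := by
  have h : 2 * (expMoment N 2 x * expMoment N 0 x - expMoment N 1 x ^ 2) =
      ∑ a, ∑ b, (weight N a - weight N b) ^ 2 *
        (Real.exp (x * weight N a) * Real.exp (x * weight N b)) := by
    have e : ∀ a b, (weight N a - weight N b) ^ 2 *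
        (Real.exp (x * weight N a) * Real.exp (x * weight N b)) =
        (weight N a ^ 2 * Real.exp (x * weight N a)) * (weight N b ^ 0 * Real.exp (x * weight N b))
        + (weight N a ^ 0 * Real.exp (x * weight N a)) *
          (weight N b ^ 2 * Real.exp (x * weight N b))
        - 2 * ((weight N a ^ 1 * Real.exp (x * weight N a)) *
          (weight N b ^ 1 * Real.exp (x * weight N b))) := fun a b => by ring
    simp_rw [e, Finset.sum_sub_distrib, Finset.sum_add_distrib, ← Finset.mul_sum, ← Finset.sum_mul]
    unfold expMoment
    ring
  have hpos : 0 < ∑ a, ∑ b, (weight N a - weight N b) ^ 2 *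
        (Real.exp (x * weight N a) * Real.exp (x * weight N b)) := by
    refine Finset.sum_pos' (fun a _ => Finset.sum_nonneg fun b _ => by positivity)
      ⟨0, Finset.mem_univ _, ?_⟩
    refine Finset.sum_pos' (fun b _ => by positivity) ⟨Fin.last N, Finset.mem_univ _, ?_⟩
    rw [weight_zero, weight_last]
    have := spin_pos hN
    have : -spin N - spin N ≠ 0 := by linarith
    positivity
  linarith

theorem strictMono_etaDeriv {N : ℕ} (hN : 1 ≤ N) : StrictMono (etaDeriv N) := by
  refine strictMono_of_hasDerivAt_pos (hasDerivAt_etaDeriv N) fun x => ?_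
  exact div_pos (sub_pos.2 (expMoment_one_sq_lt hN x)) (pow_pos (expMoment_zero_pos N x) 2)

theorem continuous_etaDeriv (N : ℕ) : Continuous (etaDeriv N) :=
  continuous_iff_continuousAt.2 fun x => (hasDerivAt_etaDeriv N x).continuousAt

theorem continuous_eta (N : ℕ) : Continuous (eta N) :=
  continuous_iff_continuousAt.2 fun x => (hasDerivAt_eta N x).continuousAt

theorem etaDeriv_lt_spin {N : ℕ} (hN : 1 ≤ N) (x : ℝ) : etaDeriv N x < spin N := by
  unfold etaDeriv
  rw [div_lt_iff₀ (expMoment_zero_pos N x)]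
  unfold expMoment
  rw [Finset.mul_sum]
  refine Finset.sum_lt_sum (fun a _ => ?_) ⟨0, Finset.mem_univ _, ?_⟩
  · have := weight_le_spin N a
    rw [pow_one, pow_zero, one_mul]; gcongr
  · have := spin_pos hN
    rw [weight_zero, pow_one, pow_zero, one_mul]
    have := Real.exp_pos (x * -spin N)
    nlinarith

theorem spin_mul_abs_le_eta (N : ℕ) (x : ℝ) : spin N * |x| ≤ eta N x := by
  rw [eta_eq_log, Real.le_log_iff_exp_le (expMoment_zero_pos N x)]
  have key : ∀ a : Fin (N + 1), Real.exp (x * weight N a) ≤ expMoment N 0 x := fun a => by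
    have := Finset.single_le_sum (f := fun a => weight N a ^ 0 * Real.exp (x * weight N a))
      (fun i _ => by positivity) (Finset.mem_univ a)
    simpa [expMoment] using this
  rcases abs_cases x with ⟨h, _⟩ | ⟨h, _⟩
  · have := key (Fin.last N)
    rw [weight_last, mul_comm] at this
    rwa [h]
  · have := key 0
    rw [weight_zero, mul_neg, ← neg_mul, mul_comm] at this
    rwa [h]

theorem exists_etaDeriv_eq {N : ℕ} {m : ℝ} (hm : m ∈ Set.Ioo (-spin N) (spin N)) :
    ∃ x, etaDeriv N x = m := by
  have hc : Continuous fun x => eta N x - m * x := (continuous_eta N).sub (by fun_prop)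
  have hm' : |m| < spin N := abs_lt.2 hm
  have ht : Filter.Tendsto (fun x => eta N x - m * x) (Filter.cocompact ℝ) Filter.atTop := by
    refine Filter.tendsto_atTop_mono (f := fun x => (spin N - |m|) * ‖x‖) (fun x => ?_)
      (Filter.Tendsto.const_mul_atTop (sub_pos.2 hm') tendsto_norm_cocompact_atTop)
    have h1 := spin_mul_abs_le_eta N x
    have h2 : m * x ≤ |m| * |x| := (le_abs_self _).trans (abs_mul m x).le
    rw [Real.norm_eq_abs]; linarith
  obtain ⟨x, hx⟩ := hc.exists_forall_le ht
  refine ⟨x, ?_⟩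
  have hmin : IsLocalMin (fun x => eta N x - m * x) x := Filter.Eventually.of_forall hx
  have := hmin.hasDerivAt_eq_zero ((hasDerivAt_eta N x).sub ((hasDerivAt_id x).const_mul m))
  linarith

theorem existsUnique_hasDerivAt_eta {N : ℕ} (hN : 1 ≤ N) {m : ℝ}
    (hm : m ∈ Set.Ioo (-spin N) (spin N)) : ∃! x : ℝ, HasDerivAt (eta N) m x := by
  obtain ⟨x, hx⟩ := exists_etaDeriv_eq hm
  refine ⟨x, hasDerivAt_eta_iff.2 hx, fun y hy => ?_⟩
  exact (strictMono_etaDeriv hN).injective ((hasDerivAt_eta_iff.1 hy).trans hx.symm)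

theorem etaDeriv_xStar {N : ℕ} {m : ℝ} (hm : m ∈ Set.Ioo (-spin N) (spin N)) :
    etaDeriv N (xStar N m) = m := by
  obtain ⟨x, hx⟩ := exists_etaDeriv_eq hm
  exact hasDerivAt_eta_iff.1 (Classical.epsilon_spec (p := fun x => HasDerivAt (eta N) m x)
    ⟨x, hasDerivAt_eta_iff.2 hx⟩)

theorem xStar_etaDeriv {N : ℕ} (hN : 1 ≤ N) (x : ℝ) : xStar N (etaDeriv N x) = x := by
  refine (strictMono_etaDeriv hN).injective (etaDeriv_xStar ⟨?_, etaDeriv_lt_spin hN x⟩)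
  have := etaDeriv_lt_spin hN (-x)
  rw [etaDeriv_neg] at this; linarith

/-- The tangent line inequality for the strictly convex function `eta`. -/
theorem eta_tangent_lt {N : ℕ} (hN : 1 ≤ N) {x y : ℝ} (hxy : y ≠ x) :
    eta N x + etaDeriv N x * (y - x) < eta N y := by
  have hd : Differentiable ℝ (eta N) := fun x => (hasDerivAt_eta N x).differentiableAt
  have hderiv : ∀ z, deriv (eta N) z = etaDeriv N z := fun z => (hasDerivAt_eta N z).deriv
  rcases lt_or_gt_of_ne hxy with h | h
  · obtain ⟨z, hz, he⟩ := exists_deriv_eq_slope (eta N) h hd.continuous.continuousOn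
      hd.differentiableOn
    rw [hderiv, eq_div_iff (by linarith)] at he
    have := strictMono_etaDeriv hN hz.2
    nlinarith
  · obtain ⟨z, hz, he⟩ := exists_deriv_eq_slope (eta N) h hd.continuous.continuousOn
      hd.differentiableOn
    rw [hderiv, eq_div_iff (by linarith)] at he
    have := strictMono_etaDeriv hN hz.1
    nlinarith

theorem legendre_lt {N : ℕ} (hN : 1 ≤ N) {m : ℝ} (hm : m ∈ Set.Ioo (-spin N) (spin N)) {x : ℝ}
    (hx : x ≠ xStar N m) : eta N (xStar N m) - m * xStar N m < eta N x - m * x := by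
  have := eta_tangent_lt hN hx
  rw [etaDeriv_xStar hm] at this
  linarith

end SpinSystem

namespace SpinSystem

open Real in
theorem sinh_gt_add_cube {y : ℝ} (hy : 0 < y) : y + y ^ 3 / 6 < sinh y := by
  have hmono : StrictMonoOn (fun y : ℝ => sinh y - y - y ^ 3 / 6) (Set.Ici 0) := by
    refine strictMonoOn_of_deriv_pos (convex_Ici 0) (by fun_prop) fun x hx => ?_
    rw [interior_Ici] at hx
    have hx : 0 < x := hx
    have hd : HasDerivAt (fun y : ℝ => sinh y - y - y ^ 3 / 6) (cosh x - 1 - 3 * x ^ 2 / 6) x := by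
      have := ((hasDerivAt_sinh x).sub (hasDerivAt_id x)).sub ((hasDerivAt_pow 3 x).div_const 6)
      exact (this.congr_deriv (by norm_num)).congr_of_eventuallyEq
        (Filter.Eventually.of_forall fun _ => rfl)
    rw [hd.deriv]
    have h2 := self_lt_sinh_iff.2 (half_pos hx)
    have h3 : cosh x = 1 + 2 * sinh (x / 2) ^ 2 := by
      have := cosh_two_mul (x / 2)
      rw [mul_div_cancel₀ _ two_ne_zero] at this
      rw [this, cosh_sq]; ring
    rw [h3]
    nlinarith
  have := hmono (Set.self_mem_Ici) hy.le hy
  simp only [sinh_zero] at this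
  linarith

open Real in
theorem sinh_le_self_mul_cosh {y : ℝ} (hy : 0 ≤ y) : sinh y ≤ y * cosh y := by
  have hd : ∀ x : ℝ, HasDerivAt (fun y : ℝ => y * cosh y - sinh y) (x * sinh x) x := fun x => by
    have := ((hasDerivAt_id x).mul (hasDerivAt_cosh x)).sub (hasDerivAt_sinh x)
    exact (this.congr_deriv (by simp)).congr_of_eventuallyEq
      (Filter.Eventually.of_forall fun _ => rfl)
  have hmono : MonotoneOn (fun y : ℝ => y * cosh y - sinh y) (Set.Ici 0) := by
    refine monotoneOn_of_deriv_nonneg (convex_Ici 0)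
      (fun x _ => (hd x).continuousAt.continuousWithinAt)
      (fun x _ => (hd x).differentiableAt.differentiableWithinAt) fun x hx => ?_
    rw [interior_Ici] at hx
    have hx : 0 < x := hx
    rw [(hd x).deriv]
    exact mul_nonneg hx.le (sinh_nonneg_iff.2 hx.le)
  have := hmono (Set.self_mem_Ici) hy hy
  simp only [sinh_zero, zero_mul, sub_zero] at this
  linarith

open Real in
theorem sub_cube_le_tanh {y : ℝ} (hy : 0 ≤ y) : (y - y ^ 3 / 3) * cosh y ≤ sinh y := by
  have hmono : MonotoneOn (fun y : ℝ => sinh y / cosh y - y + y ^ 3 / 3) (Set.Ici 0) := by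
    have hd : ∀ x : ℝ, HasDerivAt (fun y : ℝ => sinh y / cosh y - y + y ^ 3 / 3)
        ((cosh x * cosh x - sinh x * sinh x) / cosh x ^ 2 - 1 + 3 * x ^ 2 / 3) x := fun x => by
      have := ((((hasDerivAt_sinh x).div (hasDerivAt_cosh x) (cosh_pos x).ne').sub
        (hasDerivAt_id x))).add ((hasDerivAt_pow 3 x).div_const 3)
      exact (this.congr_deriv (by norm_num)).congr_of_eventuallyEq
        (Filter.Eventually.of_forall fun _ => rfl)
    refine monotoneOn_of_deriv_nonneg (convex_Ici 0)
      (fun x _ => (hd x).continuousAt.continuousWithinAt)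
      (fun x _ => (hd x).differentiableAt.differentiableWithinAt) fun x hx => ?_
    rw [interior_Ici] at hx
    have hx : 0 < x := hx
    rw [(hd x).deriv]
    have hc := cosh_pos x
    have hs := sinh_le_self_mul_cosh hx.le
    have hs0 : 0 < sinh x := sinh_pos_iff.2 hx
    have h3 : sinh x * sinh x ≤ x ^ 2 * cosh x ^ 2 := by nlinarith
    have h4 : (cosh x * cosh x - sinh x * sinh x) / cosh x ^ 2 - 1 + 3 * x ^ 2 / 3
        = (x ^ 2 * cosh x ^ 2 - sinh x * sinh x) / cosh x ^ 2 := by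
      field_simp; ring
    rw [h4]
    exact div_nonneg (by linarith) (by positivity)
  have := hmono (Set.self_mem_Ici) hy hy
  simp only [sinh_zero, zero_div] at this
  have hc := cosh_pos y
  have h5 : y - y ^ 3 / 3 ≤ sinh y / cosh y := by linarith
  rwa [le_div_iff₀ hc] at h5

open Real in
theorem strictMonoOn_mul_coth_add :
    StrictMonoOn (fun y : ℝ => y * (cosh y / sinh y) + y ^ 2 / sinh y ^ 2) (Set.Ioi 0) := by
  have hd : ∀ x : ℝ, 0 < x → HasDerivAt (fun y : ℝ => y * (cosh y / sinh y) + y ^ 2 / sinh y ^ 2)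
      ((cosh x * sinh x ^ 2 + x * sinh x - 2 * x ^ 2 * cosh x) / sinh x ^ 3) x := fun x hx => by
    have hs : sinh x ≠ 0 := (sinh_pos_iff.2 hx).ne'
    have := ((hasDerivAt_id x).mul ((hasDerivAt_cosh x).div (hasDerivAt_sinh x) hs)).add
      ((hasDerivAt_pow 2 x).div ((hasDerivAt_sinh x).pow 2) (pow_ne_zero 2 hs))
    refine (this.congr_deriv ?_).congr_of_eventuallyEq (Filter.Eventually.of_forall fun _ => rfl)
    simp only [id, Pi.pow_apply, Pi.div_apply]
    have hc := cosh_sq x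
    field_simp
    norm_num
    linear_combination (-x * sinh x ^ 2) * hc
  refine strictMonoOn_of_deriv_pos (convex_Ioi 0)
    (fun x hx => (hd x hx).continuousAt.continuousWithinAt) fun x hx => ?_
  rw [interior_Ioi] at hx
  have hx : 0 < x := hx
  rw [(hd x hx).deriv]
  have hs := sinh_pos_iff.2 hx
  refine div_pos ?_ (by positivity)
  have h1 := sinh_gt_add_cube hx
  have h2 := sub_cube_le_tanh hx.le
  have hc := cosh_pos x
  have h3 : x ^ 2 + x ^ 4 / 3 < sinh x ^ 2 := by
    have : (x + x ^ 3 / 6) ^ 2 < sinh x ^ 2 := by gcongr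
    nlinarith [pow_pos hx 6]
  nlinarith [mul_lt_mul_of_pos_left h3 hc, mul_le_mul_of_nonneg_left h2 hx.le]

open Real in
theorem etaDeriv_eq_coth {N : ℕ} {x : ℝ} (hx : 0 < x) :
    etaDeriv N (2 * x) = (((N : ℝ) + 1) * (cosh ((N + 1) * x) / sinh ((N + 1) * x))
      - cosh x / sinh x) / 2 := by
  have h := hasDerivAt_eta N (2 * x)
  have hs : sinh (1 / 2 * (2 * x)) ≠ 0 := (sinh_pos_iff.2 (by linarith)).ne'
  have hp : 0 < (2 * spin N + 1) / 2 := by have := spin_nonneg N; positivity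
  have hs2 : sinh ((2 * spin N + 1) / 2 * (2 * x)) ≠ 0 :=
    (sinh_pos_iff.2 (mul_pos hp (by linarith))).ne'
  have h1 : HasDerivAt (fun z : ℝ => log (sinh ((2 * spin N + 1) / 2 * z)) - log (sinh (1 / 2 * z)))
      (cosh ((2 * spin N + 1) / 2 * (2 * x)) * ((2 * spin N + 1) / 2 * 1) /
        sinh ((2 * spin N + 1) / 2 * (2 * x)) -
        cosh (1 / 2 * (2 * x)) * (1 / 2 * 1) / sinh (1 / 2 * (2 * x))) (2 * x) :=
    ((((hasDerivAt_id (2 * x)).const_mul _).sinh).log hs2).sub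
      ((((hasDerivAt_id (2 * x)).const_mul _).sinh).log hs)
  have h2 : (fun z : ℝ => log (sinh ((2 * spin N + 1) / 2 * z)) - log (sinh (1 / 2 * z)))
      =ᶠ[nhds (2 * x)] eta N := by
    filter_upwards [lt_mem_nhds (show 0 < 2 * x by linarith)] with z hz
    rw [eta, if_neg hz.ne', log_div]
    · exact (sinh_pos_iff.2 (mul_pos hp hz)).ne'
    · exact (sinh_pos_iff.2 (by linarith)).ne'
  rw [h.unique (h1.congr_of_eventuallyEq h2.symm)]
  rw [show 2 * spin N = N by unfold spin; ring, show ((N : ℝ) + 1) / 2 * (2 * x) = (N + 1) * x by ring,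
    show 1 / 2 * (2 * x) = x by ring]
  ring

open Real in
theorem strictAntiOn_etaDeriv_div {N : ℕ} (hN : 1 ≤ N) :
    StrictAntiOn (fun x => etaDeriv N x / x) (Set.Ioi 0) := by
  have hp : (1 : ℝ) < N + 1 := by have : (1 : ℝ) ≤ N := by exact_mod_cast hN
                                  linarith
  set p : ℝ := N + 1 with hpdef
  have hp0 : 0 < p := by linarith
  have hd : ∀ x : ℝ, 0 < x → HasDerivAt
      (fun y : ℝ => (p * (cosh (p * y) / sinh (p * y)) - cosh y / sinh y) / y)
      (((x * (cosh x / sinh x) + x ^ 2 / sinh x ^ 2)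
        - ((p * x) * (cosh (p * x) / sinh (p * x)) + (p * x) ^ 2 / sinh (p * x) ^ 2)) / x ^ 3) x := by
    intro x hx
    have hs : sinh x ≠ 0 := (sinh_pos_iff.2 hx).ne'
    have hs2 : sinh (p * x) ≠ 0 := (sinh_pos_iff.2 (mul_pos hp0 hx)).ne'
    have hl := (hasDerivAt_id x).const_mul p
    have := ((((hl.cosh).div hl.sinh hs2).const_mul p).sub
      ((hasDerivAt_cosh x).div (hasDerivAt_sinh x) hs)).div (hasDerivAt_id x) hx.ne'
    refine (this.congr_deriv ?_).congr_of_eventuallyEq (Filter.Eventually.of_forall fun _ => rfl)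
    simp only [id, Pi.div_apply]
    have hc := cosh_sq x
    have hc2 := cosh_sq (p * x)
    have e1 : (sinh x * sinh x - cosh x * cosh x) = -1 := by linear_combination -hc
    have e2 : (sinh (p * x) * (p * 1) * sinh (p * x) - cosh (p * x) * (cosh (p * x) * (p * 1)))
        = -p := by linear_combination -p * hc2
    simp only [Pi.sub_apply, Pi.div_apply, e1, e2]
    field_simp
    ring
  have hanti : StrictAntiOn
      (fun y : ℝ => (p * (cosh (p * y) / sinh (p * y)) - cosh y / sinh y) / y) (Set.Ioi 0) := by
    refine strictAntiOn_of_deriv_neg (convex_Ioi 0)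
      (fun x hx => (hd x hx).continuousAt.continuousWithinAt) fun x hx => ?_
    rw [interior_Ioi] at hx
    have hx : 0 < x := hx
    rw [(hd x hx).deriv]
    refine div_neg_of_neg_of_pos (sub_neg.2 ?_) (by positivity)
    exact strictMonoOn_mul_coth_add hx (mul_pos hp0 hx) (by nlinarith)
  intro x hx y hy hxy
  have hx : 0 < x := hx
  have hy : 0 < y := hy
  have e : ∀ z : ℝ, 0 < z → etaDeriv N z / z =
      ((p * (cosh (p * (z / 2)) / sinh (p * (z / 2))) - cosh (z / 2) / sinh (z / 2)) / (z / 2)) / 4 := by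
    intro z hz
    have := etaDeriv_eq_coth (N := N) (half_pos hz)
    rw [mul_div_cancel₀ _ two_ne_zero] at this
    rw [this, ← hpdef]
    field_simp
    ring
  have h := hanti (half_pos hx) (half_pos hy) (show x / 2 < y / 2 by linarith)
  show etaDeriv N y / y < etaDeriv N x / x
  rw [e x hx, e y hy]
  simp only at h
  linarith

theorem expMoment_two_zero (N : ℕ) :
    expMoment N 2 0 = (N + 1) * (spin N * (spin N + 1) / 3) := by
  have h : ∀ (s : ℝ) (n : ℕ), ∑ a ∈ Finset.range (n + 1), ((a : ℝ) - s) ^ 2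
      = (n + 1) * (n * (2 * n + 1) / 6 - n * s + s ^ 2) := by
    intro s n
    induction n with
    | zero => simp
    | succ k ih => rw [Finset.sum_range_succ, ih]; push_cast; ring
  have h2 := h (spin N) N
  rw [← Fin.sum_univ_eq_sum_range (fun a : ℕ => ((a : ℝ) - spin N) ^ 2)] at h2
  unfold expMoment weight
  simp only [zero_mul, Real.exp_zero, mul_one]
  rw [h2]
  unfold spin
  ring

theorem hasDerivAt_etaDeriv_zero (N : ℕ) :
    HasDerivAt (etaDeriv N) (spin N * (spin N + 1) / 3) 0 := by
  refine (hasDerivAt_etaDeriv N 0).congr_deriv ?_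
  have h0 : expMoment N 0 0 = N + 1 := by simp [expMoment]
  have h1 : expMoment N 1 0 = 0 := by
    have := expMoment_neg N 1 0
    rw [neg_zero] at this; linarith
  rw [expMoment_two_zero, h0, h1]
  have : (N : ℝ) + 1 ≠ 0 := by positivity
  field_simp
  ring

theorem tendsto_etaDeriv_div (N : ℕ) : Filter.Tendsto (fun x => etaDeriv N x / x)
    (nhdsWithin 0 (Set.Ioi 0)) (nhds (spin N * (spin N + 1) / 3)) := by
  have h := (hasDerivAt_iff_tendsto_slope.1 (hasDerivAt_etaDeriv_zero N)).mono_left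
    (nhdsWithin_mono 0 (fun x hx => (ne_of_gt hx : x ≠ 0)) :
      nhdsWithin (0 : ℝ) (Set.Ioi 0) ≤ nhdsWithin 0 {0}ᶜ)
  refine h.congr fun x => ?_
  rw [slope_def_field, etaDeriv_zero, sub_zero, sub_zero]

theorem etaDeriv_div_lt {N : ℕ} (hN : 1 ≤ N) {x : ℝ} (hx : 0 < x) :
    etaDeriv N x / x < spin N * (spin N + 1) / 3 := by
  have h1 : etaDeriv N x / x < etaDeriv N (x / 2) / (x / 2) :=
    strictAntiOn_etaDeriv_div hN (half_pos hx) hx (half_lt_self hx)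
  refine h1.trans_le (ge_of_tendsto (tendsto_etaDeriv_div N) ?_)
  filter_upwards [Ioo_mem_nhdsGT (half_pos hx)] with y hy
  exact (strictAntiOn_etaDeriv_div hN hy.1 (half_pos hx) hy.2).le

/-- The variational functional `η(2βs) - βs²`, whose maximiser on `[0, ∞)` is `m⋆(β)`. -/
def freeEnergy (N : ℕ) (β s : ℝ) : ℝ := eta N (2 * β * s) - β * s ^ 2

theorem hasDerivAt_freeEnergy (N : ℕ) (β s : ℝ) :
    HasDerivAt (freeEnergy N β) (2 * β * (etaDeriv N (2 * β * s) - s)) s := by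
  have h1 := (hasDerivAt_eta N (2 * β * s)).comp s ((hasDerivAt_id s).const_mul (2 * β))
  have := h1.sub ((hasDerivAt_pow 2 s).const_mul β)
  refine (this.congr_deriv ?_).congr_of_eventuallyEq (Filter.Eventually.of_forall fun _ => rfl)
  norm_num
  ring

theorem continuous_freeEnergy (N : ℕ) (β : ℝ) : Continuous (freeEnergy N β) :=
  continuous_iff_continuousAt.2 fun x => (hasDerivAt_freeEnergy N β x).continuousAt

theorem freeEnergy_abs (N : ℕ) (β s : ℝ) : freeEnergy N β |s| = freeEnergy N β s := by
  rcases abs_choice s with h | h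
  · rw [h]
  · rw [h, freeEnergy, freeEnergy, mul_neg, eta_neg, neg_sq]

theorem betaC_lt_iff {N : ℕ} (hN : 1 ≤ N) {β : ℝ} :
    betaC N < β ↔ 1 < 2 * β * (spin N * (spin N + 1) / 3) := by
  have := spin_pos hN
  unfold betaC
  rw [div_lt_iff₀ (by positivity)]
  constructor <;> intro h <;> nlinarith

/-- For `β > 0` the mean field equation `η'(2βm) = m` has a solution `m ∈ [0, S)`
below which `η'(2βs) > s` and above which `η'(2βs) < s`. -/
theorem exists_meanField {N : ℕ} (hN : 1 ≤ N) {β : ℝ} (hβ : 0 < β) :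
    ∃ m ∈ Set.Ico 0 (spin N), etaDeriv N (2 * β * m) = m ∧ (0 < m ↔ betaC N < β) ∧
      (∀ s, 0 < s → s < m → s < etaDeriv N (2 * β * s)) ∧
      (∀ s, m < s → etaDeriv N (2 * β * s) < s) := by
  have hS := spin_pos hN
  have key : ∀ s : ℝ, 0 < s → etaDeriv N (2 * β * s) = s * (2 * β *
      (etaDeriv N (2 * β * s) / (2 * β * s))) := fun s hs => by field_simp
  by_cases hc : betaC N < β
  · have h1 := (betaC_lt_iff hN).1 hc
    obtain ⟨s₀, hs₀, hs₀S, hs₀'⟩ : ∃ s, 0 < s ∧ s < spin N ∧ s < etaDeriv N (2 * β * s) := by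
      have h2 : ∀ᶠ x in nhdsWithin (0 : ℝ) (Set.Ioi 0), 1 / (2 * β) < etaDeriv N x / x := by
        refine (tendsto_etaDeriv_div N).eventually (lt_mem_nhds ?_)
        rw [div_lt_iff₀ (by positivity)]; linarith
      obtain ⟨x, hx, hx0, hxS⟩ := (h2.and (Ioo_mem_nhdsGT (show 0 < 2 * β * spin N by positivity))).exists
      refine ⟨x / (2 * β), by positivity, by rw [div_lt_iff₀ (by positivity)]; linarith, ?_⟩
      rw [mul_div_cancel₀ _ (by positivity)]
      rw [lt_div_iff₀ hx0] at hx
      rwa [div_mul_eq_mul_div, one_mul] at hx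
    have hcont : Continuous fun s => etaDeriv N (2 * β * s) - s :=
      ((continuous_etaDeriv N).comp (by fun_prop)).sub continuous_id
    obtain ⟨m, hm, hm0⟩ := intermediate_value_Ioo' hs₀S.le hcont.continuousOn
      (show (0 : ℝ) ∈ Set.Ioo (etaDeriv N (2 * β * spin N) - spin N) (etaDeriv N (2 * β * s₀) - s₀)
        from ⟨sub_neg.2 (etaDeriv_lt_spin hN _), sub_pos.2 hs₀'⟩)
    have hmpos : 0 < m := hs₀.trans hm.1
    have hmeq : etaDeriv N (2 * β * m) = m := by linarith
    have hr : 2 * β * (etaDeriv N (2 * β * m) / (2 * β * m)) = 1 := by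
      rw [hmeq]; field_simp
    refine ⟨m, ⟨hmpos.le, hm.2⟩, hmeq, by simp [hmpos, hc], fun s hs hsm => ?_, fun s hs => ?_⟩
    · have := strictAntiOn_etaDeriv_div hN (show 0 < 2 * β * s by positivity)
        (show 0 < 2 * β * m by positivity) (by gcongr)
      have h3 := mul_lt_mul_of_pos_left this (show 0 < 2 * β by positivity)
      simp only [hr] at h3
      rw [key s hs]
      exact lt_mul_of_one_lt_right hs h3
    · have hs0 := hmpos.trans hs
      have := strictAntiOn_etaDeriv_div hN (show 0 < 2 * β * m by positivity)
        (show 0 < 2 * β * s by positivity) (by gcongr)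
      have h3 := mul_lt_mul_of_pos_left this (show 0 < 2 * β by positivity)
      simp only [hr] at h3
      rw [key s hs0]
      exact mul_lt_of_lt_one_right hs0 h3
  · have h1 := mt (betaC_lt_iff hN).2 hc
    refine ⟨0, ⟨le_rfl, hS⟩, by rw [mul_zero, etaDeriv_zero], by simpa using hc,
      fun s hs hs' => absurd hs' hs.not_gt, fun s hs => ?_⟩
    have := mul_lt_mul_of_pos_left (etaDeriv_div_lt hN (show 0 < 2 * β * s by positivity))
      (show 0 < 2 * β by positivity)
    rw [key s hs]
    exact mul_lt_of_lt_one_right hs (by linarith)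

theorem freeEnergy_lt {N : ℕ} {β : ℝ} (hβ : 0 < β) {m : ℝ}
    (hm : 0 ≤ m) (h1 : ∀ s, 0 < s → s < m → s < etaDeriv N (2 * β * s))
    (h2 : ∀ s, m < s → etaDeriv N (2 * β * s) < s) {s : ℝ} (hs : 0 ≤ s) (hsm : s ≠ m) :
    freeEnergy N β s < freeEnergy N β m := by
  have hcont := continuous_freeEnergy N β
  rcases lt_or_gt_of_ne hsm with h | h
  · have : StrictMonoOn (freeEnergy N β) (Set.Icc 0 m) := by
      refine strictMonoOn_of_deriv_pos (convex_Icc 0 m) hcont.continuousOn fun x hx => ?_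
      rw [interior_Icc] at hx
      rw [(hasDerivAt_freeEnergy N β x).deriv]
      have := h1 x hx.1 hx.2
      exact mul_pos (by positivity) (by linarith)
    exact this ⟨hs, h.le⟩ ⟨hm, le_rfl⟩ h
  · have : StrictAntiOn (freeEnergy N β) (Set.Ici m) := by
      refine strictAntiOn_of_deriv_neg (convex_Ici m) hcont.continuousOn fun x hx => ?_
      rw [interior_Ici] at hx
      rw [(hasDerivAt_freeEnergy N β x).deriv]
      have := h2 x hx
      exact mul_neg_of_pos_of_neg (by positivity) (by linarith)
    exact this Set.self_mem_Ici h.le h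

theorem gFun_le_freeEnergy {N : ℕ} (hN : 1 ≤ N) {β m : ℝ} (hm : m ∈ Set.Ico 0 (spin N)) :
    gFun N β m ≤ freeEnergy N β m := by
  have hm' : m ∈ Set.Ioo (-spin N) (spin N) := ⟨by linarith [hm.1, spin_pos hN], hm.2⟩
  unfold gFun freeEnergy
  by_cases h : 2 * β * m = xStar N m
  · rw [← h]; nlinarith
  · have := legendre_lt hN hm' h
    nlinarith

theorem gFun_eq_freeEnergy {N : ℕ} (hN : 1 ≤ N) {β m : ℝ} (hm : etaDeriv N (2 * β * m) = m) :
    gFun N β m = freeEnergy N β m := by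
  have := xStar_etaDeriv hN (2 * β * m)
  rw [hm] at this
  rw [gFun, this, freeEnergy]; ring

theorem isMaximiser_unique_of_lt {N : ℕ} {β m₀ : ℝ} (hm₀ : m₀ ∈ Set.Ico 0 (spin N))
    (h : ∀ m ∈ Set.Ico 0 (spin N), m ≠ m₀ → gFun N β m < gFun N β m₀) :
    IsMaximiser N β m₀ ∧ ∀ m, IsMaximiser N β m → m = m₀ := by
  refine ⟨⟨hm₀, fun m hm => ?_⟩, fun m hm => ?_⟩
  · change gFun N β m ≤ gFun N β m₀
    by_cases hmm : m = m₀
    · rw [hmm]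
    · exact (h m hm hmm).le
  · by_contra hmm
    exact (h m hm.1 hmm).not_ge (hm.2 hm₀)

theorem isMaximiser_zero_of_nonpos {N : ℕ} (hN : 1 ≤ N) {β : ℝ} (hβ : β ≤ 0) :
    IsMaximiser N β 0 ∧ ∀ m, IsMaximiser N β m → m = 0 := by
  have hS := spin_pos hN
  refine isMaximiser_unique_of_lt ⟨le_rfl, hS⟩ fun m hm hm0 => ?_
  have hm' : m ∈ Set.Ioo (-spin N) (spin N) := ⟨by linarith [hm.1], hm.2⟩
  have hx0 : xStar N 0 = 0 := by
    have := xStar_etaDeriv hN 0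
    rwa [etaDeriv_zero] at this
  have hne : (0 : ℝ) ≠ xStar N m := fun h => hm0 (by
    rw [← etaDeriv_xStar hm', ← h, etaDeriv_zero])
  have := legendre_lt hN hm' hne
  unfold gFun
  rw [hx0]
  nlinarith [sq_nonneg m]

theorem mStar_eq {N : ℕ} {β m₀ : ℝ}
    (h : IsMaximiser N β m₀ ∧ ∀ m, IsMaximiser N β m → m = m₀) : mStar N β = m₀ :=
  h.2 _ (Classical.epsilon_spec (p := IsMaximiser N β) ⟨m₀, h.1⟩)

theorem isMaximiser_of_meanField {N : ℕ} (hN : 1 ≤ N) {β : ℝ} (hβ : 0 < β) {m : ℝ}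
    (hm : m ∈ Set.Ico 0 (spin N)) (h0 : etaDeriv N (2 * β * m) = m)
    (h1 : ∀ s, 0 < s → s < m → s < etaDeriv N (2 * β * s))
    (h2 : ∀ s, m < s → etaDeriv N (2 * β * s) < s) :
    IsMaximiser N β m ∧ ∀ m', IsMaximiser N β m' → m' = m := by
  refine isMaximiser_unique_of_lt hm fun s hs hsm => ?_
  rw [gFun_eq_freeEnergy hN h0]
  exact (gFun_le_freeEnergy hN hs).trans_lt (freeEnergy_lt hβ hm.1 h1 h2 hs.1 hsm)

theorem betaC_pos {N : ℕ} (hN : 1 ≤ N) : 0 < betaC N := by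
  have := spin_pos hN
  unfold betaC; positivity

theorem existsUnique_isMaximiser {N : ℕ} (hN : 1 ≤ N) (β : ℝ) : ∃! m, IsMaximiser N β m := by
  rcases le_or_gt β 0 with hβ | hβ
  · exact ⟨0, isMaximiser_zero_of_nonpos hN hβ⟩
  · obtain ⟨m, hm, h0, -, h1, h2⟩ := exists_meanField hN hβ
    exact ⟨m, isMaximiser_of_meanField hN hβ hm h0 h1 h2⟩

theorem mStar_pos_iff {N : ℕ} (hN : 1 ≤ N) (β : ℝ) : 0 < mStar N β ↔ betaC N < β := by
  rcases le_or_gt β 0 with hβ | hβ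
  · rw [mStar_eq (isMaximiser_zero_of_nonpos hN hβ)]
    have := betaC_pos hN
    exact iff_of_false (lt_irrefl _) (by linarith)
  · obtain ⟨m, hm, h0, hpos, h1, h2⟩ := exists_meanField hN hβ
    rwa [mStar_eq (isMaximiser_of_meanField hN hβ hm h0 h1 h2)]

theorem freeEnergy_lt_mStar {N : ℕ} (hN : 1 ≤ N) {β : ℝ} (hβ : 0 < β) {s : ℝ}
    (hsm : |s| ≠ mStar N β) : freeEnergy N β s < freeEnergy N β (mStar N β) := by
  obtain ⟨m, hm, h0, -, h1, h2⟩ := exists_meanField hN hβ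
  rw [mStar_eq (isMaximiser_of_meanField hN hβ hm h0 h1 h2)] at hsm ⊢
  rw [← freeEnergy_abs]
  exact freeEnergy_lt hβ hm.1 h1 h2 (abs_nonneg s) hsm

theorem mStar_nonneg {N : ℕ} (hN : 1 ≤ N) (β : ℝ) : 0 ≤ mStar N β := by
  obtain ⟨m, hm⟩ := existsUnique_isMaximiser hN β
  rw [mStar_eq hm]
  exact hm.1.1.1

end SpinSystem

namespace SpinSystem

open Matrix

section Site

variable {N n : ℕ}

theorem atSite_mul_apply (A : Matrix (Fin (N + 1)) (Fin (N + 1)) ℂ) (i : Fin n) (M : Op N n)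
    (σ τ : Fin n → Fin (N + 1)) :
    (atSite A i * M) σ τ = ∑ a, A (σ i) a * M (Function.update σ i a) τ := by
  rw [mul_apply]
  symm
  refine Fintype.sum_of_injective (fun a => Function.update σ i a)
    (Function.update_injective σ i) _ _ (fun ρ hρ => ?_) fun a => ?_
  · rw [atSite, of_apply, if_neg, zero_mul]
    intro h
    refine hρ ⟨ρ i, ?_⟩
    ext j
    by_cases hj : j = i
    · subst hj; simp
    · simp [hj, h j hj]
  · rw [atSite, of_apply, if_pos]
    · simp
    · intro j hj; simp [hj]

theorem atSite_mul_atSite (A B : Matrix (Fin (N + 1)) (Fin (N + 1)) ℂ) (i : Fin n) :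
    atSite A i * atSite B i = atSite (A * B) i := by
  ext σ τ
  rw [atSite_mul_apply, atSite, atSite, of_apply]
  simp only [of_apply, Function.update_self, mul_apply]
  have h : ∀ a, (∀ j, j ≠ i → Function.update σ i a j = τ j) ↔ ∀ j, j ≠ i → σ j = τ j := fun a =>
    forall₂_congr fun j hj => by rw [Function.update_of_ne hj]
  simp only [h]
  split_ifs <;> simp

theorem atSite_commute (A B : Matrix (Fin (N + 1)) (Fin (N + 1)) ℂ) {i j : Fin n} (hij : i ≠ j) :
    atSite A i * atSite B j = atSite B j * atSite A i := by
  have key : ∀ (A B : Matrix (Fin (N + 1)) (Fin (N + 1)) ℂ) {i j : Fin n} (_ : i ≠ j)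
      (σ τ : Fin n → Fin (N + 1)), (atSite A i * atSite B j) σ τ =
        open Classical in if ∀ k, k ≠ i → k ≠ j → σ k = τ k then A (σ i) (τ i) * B (σ j) (τ j)
          else 0 := by
    intro A B i j hij σ τ
    rw [atSite_mul_apply, Fintype.sum_eq_single (τ i)]
    · rw [atSite, of_apply, Function.update_of_ne hij.symm]
      have h : (∀ k, k ≠ j → Function.update σ i (τ i) k = τ k) ↔
          ∀ k, k ≠ i → k ≠ j → σ k = τ k := by
        refine forall_congr' fun k => ?_
        by_cases hk : k = i
        · subst hk; simp
        · simp [hk]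
      simp only [h]
      split_ifs <;> simp
    · intro a ha
      rw [atSite, of_apply, if_neg, mul_zero]
      intro h
      exact ha (by simpa using h i hij)
  ext σ τ
  rw [key A B hij, key B A hij.symm]
  have h : (∀ k, k ≠ i → k ≠ j → σ k = τ k) ↔ (∀ k, k ≠ j → k ≠ i → σ k = τ k) :=
    forall_congr' fun k => ⟨fun h a b => h b a, fun h a b => h b a⟩
  simp only [h, mul_comm]

theorem atSite_add (A B : Matrix (Fin (N + 1)) (Fin (N + 1)) ℂ) (i : Fin n) :
    atSite (A + B) i = atSite A i + atSite B i := by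
  ext σ τ
  simp only [atSite, of_apply, Matrix.add_apply]
  split_ifs <;> simp

theorem atSite_smul (c : ℂ) (A : Matrix (Fin (N + 1)) (Fin (N + 1)) ℂ) (i : Fin n) :
    atSite (c • A) i = c • atSite A i := by
  ext σ τ
  simp only [atSite, of_apply, Matrix.smul_apply]
  split_ifs <;> simp

theorem atSite_sub (A B : Matrix (Fin (N + 1)) (Fin (N + 1)) ℂ) (i : Fin n) :
    atSite (A - B) i = atSite A i - atSite B i := by
  ext σ τ
  simp only [atSite, of_apply, Matrix.sub_apply]
  split_ifs <;> simp

theorem atSite_diagonal (f : Fin (N + 1) → ℂ) (i : Fin n) :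
    atSite (diagonal f) i = diagonal fun σ : Fin n → Fin (N + 1) => f (σ i) := by
  ext σ τ
  rw [atSite, of_apply, diagonal_apply, diagonal_apply]
  by_cases h : σ = τ
  · subst h; simp
  · rw [if_neg h]
    split_ifs with h1 h2
    · refine absurd (funext fun j => ?_) h
      by_cases hj : j = i
      · rw [hj, h2]
      · exact h1 j hj
    · rfl
    · rfl

theorem atSite_one (i : Fin n) : atSite (1 : Matrix (Fin (N + 1)) (Fin (N + 1)) ℂ) i = 1 := by
  rw [← diagonal_one, atSite_diagonal, diagonal_one]

/-- The sum over all sites of a one-site operator. -/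
def total (n : ℕ) (A : Matrix (Fin (N + 1)) (Fin (N + 1)) ℂ) : Op N n := ∑ i, atSite A i

theorem total_add (A B : Matrix (Fin (N + 1)) (Fin (N + 1)) ℂ) :
    total n (A + B) = total n A + total n B := by
  simp only [total, atSite_add, Finset.sum_add_distrib]

theorem total_sub (A B : Matrix (Fin (N + 1)) (Fin (N + 1)) ℂ) :
    total n (A - B) = total n A - total n B := by
  simp only [total, atSite_sub, Finset.sum_sub_distrib]

theorem total_smul (c : ℂ) (A : Matrix (Fin (N + 1)) (Fin (N + 1)) ℂ) :
    total n (c • A) = c • total n A := by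
  simp only [total, atSite_smul, Finset.smul_sum]

theorem total_commutator (A B : Matrix (Fin (N + 1)) (Fin (N + 1)) ℂ) :
    total n A * total n B - total n B * total n A = total n (A * B - B * A) := by
  have h : total n B * total n A = ∑ i : Fin n, ∑ j : Fin n, atSite B j * atSite A i := by
    rw [total, total, Finset.sum_mul_sum, Finset.sum_comm]
  rw [h, total, total, Finset.sum_mul_sum, ← Finset.sum_sub_distrib, total]
  refine Finset.sum_congr rfl fun i _ => ?_
  rw [← Finset.sum_sub_distrib, Fintype.sum_eq_single i]
  · rw [atSite_mul_atSite, atSite_mul_atSite, atSite_sub]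
  · intro j hj
    rw [atSite_commute A B hj.symm, sub_self]

end Site

section OneSite

variable (N : ℕ)

theorem spin3_mul_raising : spin3 N * raising N - raising N * spin3 N = raising N := by
  ext a b
  simp only [spin3, Matrix.sub_apply, diagonal_mul, mul_diagonal, raising, of_apply]
  split_ifs with h
  · simp only [weight, h]; push_cast; ring
  · simp

theorem spin3_mul_lowering :
    spin3 N * (raising N)ᴴ - (raising N)ᴴ * spin3 N = -(raising N)ᴴ := by
  have h := congrArg conjTranspose (spin3_mul_raising N)
  have h3 : (spin3 N)ᴴ = spin3 N := by
    rw [spin3, diagonal_conjTranspose]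
    congr 1; ext a; simp
  rw [conjTranspose_sub, conjTranspose_mul, conjTranspose_mul, h3] at h
  rw [← neg_sub, h]

theorem ladder_coeff_nonneg {b : Fin (N + 1)} :
    0 ≤ spin N * (spin N + 1) - weight N b * (weight N b + 1) := by
  have h1 := weight_le_spin N b
  have h2 := neg_spin_le_weight N b
  nlinarith

theorem lowering_mul_raising : (raising N)ᴴ * raising N =
    diagonal fun a => ((spin N * (spin N + 1) - weight N a * (weight N a + 1) : ℝ) : ℂ) := by
  ext a b
  rw [mul_apply, diagonal_apply]
  simp only [raising, conjTranspose_apply, of_apply]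
  by_cases hab : a = b
  · subst hab
    rw [if_pos rfl]
    by_cases ha : (a : ℕ) = N
    · have hw : weight N a = spin N := by rw [← weight_last, show a = Fin.last N from Fin.ext ha]
      rw [Finset.sum_eq_zero, hw]
      · simp
      · intro c _
        rw [if_neg (by have := c.2; omega)]; simp
    · rw [Fintype.sum_eq_single ⟨a + 1, by have := a.2; omega⟩]
      · rw [if_pos rfl, Complex.star_def, Complex.conj_ofReal, ← Complex.ofReal_mul,
          Real.mul_self_sqrt (ladder_coeff_nonneg N)]
      · intro c hc
        rw [if_neg (fun h => hc (Fin.ext h))]; simp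
  · rw [if_neg hab]
    refine Finset.sum_eq_zero fun c _ => ?_
    by_cases h1 : (c : ℕ) = a + 1
    · rw [if_neg (c := (c : ℕ) = b + 1) (fun h2 => hab (Fin.ext (by omega))), mul_zero]
    · rw [if_neg h1]; simp

theorem raising_mul_lowering : raising N * (raising N)ᴴ =
    diagonal fun a => ((spin N * (spin N + 1) - weight N a * (weight N a - 1) : ℝ) : ℂ) := by
  ext a b
  rw [mul_apply, diagonal_apply]
  simp only [raising, conjTranspose_apply, of_apply]
  by_cases hab : a = b
  · subst hab
    rw [if_pos rfl]
    by_cases ha : (a : ℕ) = 0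
    · have hw : weight N a = -spin N := by rw [← weight_zero, show a = 0 from Fin.ext ha]
      rw [Finset.sum_eq_zero, hw]
      · push_cast; ring
      · intro c _
        rw [if_neg (by omega)]; simp
    · rw [Fintype.sum_eq_single ⟨a - 1, by have := a.2; omega⟩]
      · have hw : weight N ⟨a - 1, by have := a.2; omega⟩ = weight N a - 1 := by
          simp only [weight]
          rw [Nat.cast_sub (by omega)]; push_cast; ring
        rw [if_pos (by simp only; omega), Complex.star_def, Complex.conj_ofReal,
          ← Complex.ofReal_mul, Real.mul_self_sqrt (ladder_coeff_nonneg N), hw]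
        congr 1; ring
      · intro c hc
        rw [if_neg (fun h => hc (Fin.ext (by simp only; omega)))]; simp
  · rw [if_neg hab]
    refine Finset.sum_eq_zero fun c _ => ?_
    by_cases h1 : (a : ℕ) = c + 1
    · rw [if_neg (c := (b : ℕ) = c + 1) (fun h2 => hab (Fin.ext (by omega)))]; simp
    · rw [if_neg h1]; simp

theorem raising_commutator_lowering :
    raising N * (raising N)ᴴ - (raising N)ᴴ * raising N = (2 : ℂ) • spin3 N := by
  rw [raising_mul_lowering, lowering_mul_raising, spin3, ← diagonal_smul, diagonal_sub]
  congr 1; ext a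
  simp only [Pi.smul_apply, smul_eq_mul]
  push_cast; ring

theorem half_add_sq_add_half_sub_sq {m : Type*} [Fintype m] (R L : Matrix m m ℂ) :
    ((1 / 2 : ℂ) • (R + L)) * ((1 / 2 : ℂ) • (R + L)) +
      ((1 / (2 * Complex.I) : ℂ) • (R - L)) * ((1 / (2 * Complex.I) : ℂ) • (R - L)) =
      (1 / 2 : ℂ) • (R * L + L * R) := by
  have hI : (1 / (2 * Complex.I)) * (1 / (2 * Complex.I)) = -(1 / 4 : ℂ) := by
    rw [div_mul_div_comm, show 2 * Complex.I * (2 * Complex.I) = 4 * (Complex.I * Complex.I) by ring,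
      Complex.I_mul_I]; norm_num
  rw [smul_mul_smul_comm, smul_mul_smul_comm, hI]
  have e1 : (R + L) * (R + L) = R * R + R * L + L * R + L * L := by noncomm_ring
  have e2 : (R - L) * (R - L) = R * R - R * L - L * R + L * L := by noncomm_ring
  rw [e1, e2]
  module

theorem casimir_one_site : spin1 N * spin1 N + spin2 N * spin2 N + spin3 N * spin3 N =
    ((spin N * (spin N + 1) : ℝ) : ℂ) • 1 := by
  rw [spin1, spin2, half_add_sq_add_half_sub_sq, raising_mul_lowering, lowering_mul_raising, spin3,
    diagonal_mul_diagonal, diagonal_add, ← diagonal_smul, diagonal_add, ← diagonal_one,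
    ← diagonal_smul]
  congr 1; ext a
  simp only [Pi.smul_apply, smul_eq_mul]
  push_cast; ring

end OneSite

end SpinSystem

namespace SpinSystem

open Matrix

section Total

variable (N n : ℕ)

/-- The total magnetization of a configuration in the product basis. -/
def magnetization {N n : ℕ} (σ : Fin n → Fin (N + 1)) : ℝ := ∑ i, weight N (σ i)

/-- The total spin operator `(∑ᵢ Sᵢ)²`, written with ladder operators. -/
def casimir : Op N n :=
  total n (raising N)ᴴ * total n (raising N) + total n (spin3 N) * total n (spin3 N)
    + total n (spin3 N)

theorem total_spin3 :
    total n (spin3 N) = diagonal fun σ => ((magnetization σ : ℝ) : ℂ) := by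
  simp only [total, spin3, atSite_diagonal]
  ext σ τ
  rw [Matrix.sum_apply]
  simp only [diagonal_apply]
  split_ifs <;> simp [magnetization]

theorem total_spin3_mul_raising : total n (spin3 N) * total n (raising N) =
    total n (raising N) * total n (spin3 N) + total n (raising N) := by
  rw [← sub_eq_iff_eq_add', total_commutator, spin3_mul_raising]

theorem total_spin3_mul_lowering : total n (spin3 N) * total n (raising N)ᴴ =
    total n (raising N)ᴴ * total n (spin3 N) - total n (raising N)ᴴ := by
  have h : total n (-(raising N)ᴴ) = -total n (raising N)ᴴ := by
    rw [← neg_one_smul ℂ, total_smul, neg_one_smul]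
  have h2 := total_commutator (spin3 N) (raising N)ᴴ (n := n)
  rw [spin3_mul_lowering, h, sub_eq_iff_eq_add] at h2
  rw [h2]; abel

theorem total_raising_mul_lowering : total n (raising N) * total n (raising N)ᴴ =
    total n (raising N)ᴴ * total n (raising N) + (2 : ℂ) • total n (spin3 N) := by
  rw [← sub_eq_iff_eq_add', total_commutator, raising_commutator_lowering, total_smul]

theorem casimir_commute_raising : Commute (casimir N n) (total n (raising N)) := by
  have h1 := total_spin3_mul_raising N n
  have h3 := total_raising_mul_lowering N n
  unfold casimir Commute SemiconjBy
  generalize total n (raising N) = P at *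
  generalize total n (raising N)ᴴ = M at *
  generalize total n (spin3 N) = Z at *
  have e1 : P * (M * P) = M * P * P + (2 : ℂ) • (P * Z + P) := by
    rw [← mul_assoc, h3, add_mul, smul_mul_assoc, h1]
  have e2 : Z * Z * P = P * Z * Z + (2 : ℂ) • (P * Z) + P := by
    rw [mul_assoc, h1, mul_add, ← mul_assoc, h1, two_smul]; noncomm_ring
  rw [add_mul, add_mul, mul_add, mul_add, e1, e2, h1, two_smul, two_smul]
  noncomm_ring

theorem casimir_commute_lowering : Commute (casimir N n) (total n (raising N)ᴴ) := by
  have h2 := total_spin3_mul_lowering N n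
  have h3 := total_raising_mul_lowering N n
  unfold casimir Commute SemiconjBy
  generalize total n (raising N) = P at *
  generalize total n (raising N)ᴴ = M at *
  generalize total n (spin3 N) = Z at *
  have e1 : M * P * M = M * (M * P) + (2 : ℂ) • (M * Z) := by
    rw [mul_assoc, h3, mul_add, mul_smul_comm]
  have e2 : Z * Z * M = M * Z * Z - (2 : ℂ) • (M * Z) + M := by
    rw [mul_assoc, h2, mul_sub, ← mul_assoc, h2, two_smul]; noncomm_ring
  rw [add_mul, add_mul, mul_add, mul_add, e1, e2, h2, two_smul]
  noncomm_ring

theorem casimir_eq_sum_sq : casimir N n = total n (spin1 N) * total n (spin1 N) +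
    total n (spin2 N) * total n (spin2 N) + total n (spin3 N) * total n (spin3 N) := by
  have h3 := total_raising_mul_lowering N n
  rw [spin1, spin2, total_smul, total_smul, total_add, total_sub, half_add_sq_add_half_sub_sq, h3,
    casimir]
  module

theorem casimir_eq_sum_sum : casimir N n = ∑ i : Fin n, ∑ j : Fin n,
    (atSite (spin1 N) i * atSite (spin1 N) j + atSite (spin2 N) i * atSite (spin2 N) j
      + atSite (spin3 N) i * atSite (spin3 N) j) := by
  rw [casimir_eq_sum_sq]
  simp only [total, Finset.sum_mul_sum, Finset.sum_add_distrib]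

theorem casimir_eq_sum_lt : casimir N n = (2 : ℂ) • ∑ i : Fin n,
    ∑ j ∈ Finset.univ.filter (fun j : Fin n => i < j),
      (atSite (spin1 N) i * atSite (spin1 N) j + atSite (spin2 N) i * atSite (spin2 N) j
        + atSite (spin3 N) i * atSite (spin3 N) j)
    + ((n * (spin N * (spin N + 1)) : ℝ) : ℂ) • 1 := by
  rw [casimir_eq_sum_sum]
  set D : Fin n → Fin n → Op N n := fun i j =>
    atSite (spin1 N) i * atSite (spin1 N) j + atSite (spin2 N) i * atSite (spin2 N) j
      + atSite (spin3 N) i * atSite (spin3 N) j with hD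
  have hsymm : ∀ i j, D i j = D j i := by
    intro i j
    by_cases h : i = j
    · rw [h]
    · simp only [hD, atSite_commute _ _ h]
  have hdiag : ∀ i, D i i = ((spin N * (spin N + 1) : ℝ) : ℂ) • 1 := by
    intro i
    simp only [hD, atSite_mul_atSite, ← atSite_add, casimir_one_site, atSite_smul, atSite_one]
  have hsplit : ∀ i, ∑ j, D i j = ∑ j ∈ Finset.univ.filter (fun j => i < j), D i j +
      ∑ j ∈ Finset.univ.filter (fun j => j < i), D i j + D i i := by
    intro i
    have h1 : ∀ j, D i j = (if i < j then D i j else 0) + (if j < i then D i j else 0)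
        + (if j = i then D i j else 0) := by
      intro j
      rcases lt_trichotomy i j with h | h | h
      · simp [h, h.not_gt, h.ne']
      · subst h; simp
      · simp [h, h.not_gt, h.ne]
    rw [Finset.sum_filter, Finset.sum_filter]
    rw [Finset.sum_congr rfl fun j _ => h1 j, Finset.sum_add_distrib, Finset.sum_add_distrib,
      Finset.sum_ite_eq' Finset.univ i, if_pos (Finset.mem_univ i)]
  have hswap : ∑ i, ∑ j ∈ Finset.univ.filter (fun j => j < i), D i j =
      ∑ i, ∑ j ∈ Finset.univ.filter (fun j => i < j), D i j := by
    simp only [Finset.sum_filter]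
    rw [Finset.sum_comm]
    refine Finset.sum_congr rfl fun i _ => Finset.sum_congr rfl fun j _ => ?_
    rw [hsymm]
  change ∑ i, ∑ j, D i j = (2 : ℂ) • ∑ i, ∑ j ∈ Finset.univ.filter (fun j => i < j), D i j + _
  simp only [hsplit, Finset.sum_add_distrib, hswap, hdiag]
  rw [Finset.sum_const, Finset.card_univ, Fintype.card_fin, two_smul, ← Nat.cast_smul_eq_nsmul ℂ,
    smul_smul]
  push_cast
  rfl

theorem heisenberg_eq (hn : n ≠ 0) (β : ℝ) : (-(β : ℂ)) • heisenberg N n 1 =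
    ((β / n : ℝ) : ℂ) • casimir N n + ((-(β * (spin N * (spin N + 1))) : ℝ) : ℂ) • 1 := by
  rw [casimir_eq_sum_lt, heisenberg]
  simp only [Complex.ofReal_one, one_smul]
  have : (n : ℂ) ≠ 0 := by exact_mod_cast hn
  rw [smul_add, smul_smul, smul_smul, smul_smul, add_assoc, ← add_smul]
  have e1 : -(β : ℂ) * -(2 / n) = ((β / n : ℝ) : ℂ) * 2 := by push_cast; ring
  have e2 : ((β / n : ℝ) : ℂ) * ((n * (spin N * (spin N + 1)) : ℝ) : ℂ) +
      ((-(β * (spin N * (spin N + 1))) : ℝ) : ℂ) = 0 := by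
    push_cast; field_simp; ring
  rw [e1, e2, zero_smul, add_zero]

end Total

end SpinSystem

namespace SpinSystem

open Matrix

section NormedAlgebra

variable {A : Type*} [NormedRing A] [NormedAlgebra ℂ A] [CompleteSpace A]

theorem exp_rotation {B X Y : A} (h1 : B * X - X * B = Y) (h2 : B * Y - Y * B = -X) :
    ∃ U V : A, U * V = 1 ∧ V * U = 1 ∧ U * X * V = Y ∧ (∀ C, Commute B C → Commute U C) := by
  let E : ℝ → A := fun θ => NormedSpace.exp (θ • B)
  have hE : ∀ θ, HasDerivAt E (E θ * B) θ := fun θ => hasDerivAt_exp_smul_const B θ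
  have hE' : ∀ θ, HasDerivAt (fun θ => E (-θ)) (-(B * E (-θ))) θ := fun θ => by
    have := (hasDerivAt_exp_smul_const' (𝕂 := ℝ) B (-θ)).scomp θ (hasDerivAt_neg θ)
    exact this.congr_deriv (by simp [E])
  have hinv : ∀ θ, E θ * E (-θ) = 1 := fun θ => by
    have hc : Commute (θ • B) (-θ • B) := by
      rw [neg_smul]; exact (Commute.refl _).neg_right
    simp only [E]
    let : NormedAlgebra ℚ A := NormedAlgebra.restrictScalars ℚ ℂ A
    rw [← NormedSpace.exp_add_of_commute hc, neg_smul, add_neg_cancel, NormedSpace.exp_zero]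
  have hcomm : ∀ θ (C : A), Commute B C → Commute (E θ) C := fun θ C h =>
    (h.smul_left θ).exp_left
  let W : ℝ → A := fun θ => Real.cos θ • X + Real.sin θ • Y
  have hW : ∀ θ, HasDerivAt W (-Real.sin θ • X + Real.cos θ • Y) θ := fun θ =>
    ((Real.hasDerivAt_cos θ).smul_const X).add ((Real.hasDerivAt_sin θ).smul_const Y)
  have hF : ∀ θ, HasDerivAt (fun θ => E (-θ) * W θ * E θ) 0 θ := fun θ => by
    have h := ((hE' θ).mul (hW θ)).mul (hE θ)
    refine h.congr_deriv ?_
    have e1 : E θ * B = B * E θ := (hcomm θ B (Commute.refl B)).eq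
    have e2 : B * E (-θ) = E (-θ) * B := (hcomm (-θ) B (Commute.refl B)).eq.symm
    have e3 : -Real.sin θ • X + Real.cos θ • Y = B * W θ - W θ * B := by
      have : B * W θ - W θ * B =
          Real.cos θ • (B * X - X * B) + Real.sin θ • (B * Y - Y * B) := by
        simp only [W, mul_add, add_mul, mul_smul_comm, smul_mul_assoc, smul_sub]
        abel
      rw [this, h1, h2, smul_neg, neg_smul, add_comm]
    change (-(B * E (-θ)) * W θ + E (-θ) * (-Real.sin θ • X + Real.cos θ • Y)) * E θ +
      (E (-θ) * W θ) * (E θ * B) = 0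
    rw [e1, e2, e3]
    noncomm_ring
  have hconst := is_const_of_deriv_eq_zero (fun θ => (hF θ).differentiableAt)
    (fun θ => (hF θ).deriv) (Real.pi / 2) 0
  simp only [W, E, Real.cos_pi_div_two, Real.sin_pi_div_two, zero_smul, one_smul, zero_add,
    Real.cos_zero, Real.sin_zero, add_zero, neg_zero, NormedSpace.exp_zero, one_mul, mul_one]
    at hconst
  have hinv' := hinv (-(Real.pi / 2))
  rw [neg_neg] at hinv'
  refine ⟨E (Real.pi / 2), E (-(Real.pi / 2)), hinv _, hinv', ?_, hcomm _⟩
  rw [← hconst]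
  change E (Real.pi / 2) * (E (-(Real.pi / 2)) * Y * E (Real.pi / 2)) * E (-(Real.pi / 2)) = Y
  calc _ = (E (Real.pi / 2) * E (-(Real.pi / 2))) * Y *
      (E (Real.pi / 2) * E (-(Real.pi / 2))) := by noncomm_ring
    _ = Y := by rw [hinv, one_mul, mul_one]

theorem hasSum_clm_exp (L : A →L[ℂ] ℂ) (b : ℂ) (X : A) :
    HasSum (fun k : ℕ => ((k.factorial : ℂ))⁻¹ * (b ^ k * L (X ^ k)))
      (L (NormedSpace.exp (b • X))) := by
  have := (NormedSpace.exp_series_hasSum_exp' (𝕂 := ℂ) (b • X)).mapL L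
  simpa [smul_pow, map_smul] using this

end NormedAlgebra

section Trace

variable (N n : ℕ)

/-- The diagonal operator which is a function of the magnetization. -/
def magDiagonal (F : ℝ → ℂ) : Op N n := diagonal fun σ => F (magnetization σ)

/-- The backward difference of a function. -/
def backDiff (F : ℝ → ℂ) (M : ℝ) : ℂ := F M - F (M - 1)

theorem magDiagonal_mul_lowering (F : ℝ → ℂ) :
    magDiagonal N n F * total n (raising N)ᴴ =
      total n (raising N)ᴴ * magDiagonal N n fun M => F (M - 1) := by
  have h := total_spin3_mul_lowering N n
  ext σ τ
  have h' := congrFun (congrFun h σ) τ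
  rw [total_spin3, Matrix.sub_apply, diagonal_mul, mul_diagonal] at h'
  rw [magDiagonal, magDiagonal, diagonal_mul, mul_diagonal]
  by_cases h0 : total n (raising N)ᴴ σ τ = 0
  · rw [h0]; simp
  · have h1 : ((magnetization σ : ℝ) : ℂ) = ((magnetization τ - 1 : ℝ) : ℂ) := by
      apply mul_right_cancel₀ h0
      rw [h']; push_cast; ring
    rw [Complex.ofReal_inj.1 h1, mul_comm]

theorem lowering_mul_raising_eq : total n (raising N)ᴴ * total n (raising N) =
    casimir N n - magDiagonal N n fun M => ((M * (M + 1) : ℝ) : ℂ) := by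
  have : (magDiagonal N n fun M => ((M * (M + 1) : ℝ) : ℂ)) =
      total n (spin3 N) * total n (spin3 N) + total n (spin3 N) := by
    rw [total_spin3, diagonal_mul_diagonal, diagonal_add, magDiagonal]
    congr 1; ext σ; push_cast; ring
  rw [this, casimir]; abel

theorem raising_mul_lowering_eq : total n (raising N) * total n (raising N)ᴴ =
    casimir N n - magDiagonal N n fun M => (((M - 1) * (M - 1 + 1) : ℝ) : ℂ) := by
  have : (magDiagonal N n fun M => (((M - 1) * (M - 1 + 1) : ℝ) : ℂ)) =
      total n (spin3 N) * total n (spin3 N) - total n (spin3 N) := by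
    rw [total_spin3, diagonal_mul_diagonal, diagonal_sub, magDiagonal]
    congr 1; ext σ; push_cast; ring
  rw [this, casimir, total_raising_mul_lowering, two_smul]; abel

theorem magDiagonal_mul (F G : ℝ → ℂ) :
    magDiagonal N n F * magDiagonal N n G = magDiagonal N n fun M => F M * G M :=
  diagonal_mul_diagonal _ _

theorem magDiagonal_sub (F G : ℝ → ℂ) :
    magDiagonal N n F - magDiagonal N n G = magDiagonal N n fun M => F M - G M :=
  diagonal_sub _ _

theorem trace_magDiagonal_casimir_mul (F : ℝ → ℂ) {K : Op N n}
    (hK : Commute K (total n (raising N)ᴴ)) :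
    (magDiagonal N n (backDiff F) * (casimir N n * K)).trace =
      (magDiagonal N n (backDiff fun M => F M * ((M * (M + 1) : ℝ) : ℂ)) * K).trace := by
  have h1 : (magDiagonal N n F * (total n (raising N)ᴴ * total n (raising N)) * K).trace =
      (magDiagonal N n (fun M => F (M - 1)) *
        (total n (raising N) * total n (raising N)ᴴ) * K).trace := by
    rw [← mul_assoc, magDiagonal_mul_lowering, mul_assoc, mul_assoc, trace_mul_comm]
    congr 1
    simp only [mul_assoc, hK.eq]
  rw [lowering_mul_raising_eq, raising_mul_lowering_eq, mul_sub, mul_sub, sub_mul, sub_mul,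
    magDiagonal_mul, magDiagonal_mul, trace_sub, trace_sub, mul_assoc, mul_assoc] at h1
  have e1 : magDiagonal N n (backDiff F) =
    magDiagonal N n F - magDiagonal N n fun M => F (M - 1) := (magDiagonal_sub N n _ _).symm
  have e2 : magDiagonal N n (backDiff fun M => F M * ((M * (M + 1) : ℝ) : ℂ)) =
    (magDiagonal N n fun M => F M * ((M * (M + 1) : ℝ) : ℂ)) -
      magDiagonal N n fun M => F (M - 1) * (((M - 1) * (M - 1 + 1) : ℝ) : ℂ) :=
    (magDiagonal_sub N n _ _).symm
  rw [e1, e2, sub_mul, sub_mul, trace_sub, trace_sub]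
  linear_combination h1

theorem trace_magDiagonal_casimir_pow (F : ℝ → ℂ) (k : ℕ) :
    (magDiagonal N n (backDiff F) * casimir N n ^ k).trace =
      ∑ σ : Fin n → Fin (N + 1),
        backDiff (fun M => F M * ((M * (M + 1) : ℝ) : ℂ) ^ k) (magnetization σ) := by
  induction k generalizing F with
  | zero => simp [magDiagonal, trace]
  | succ k ih =>
    rw [pow_succ', trace_magDiagonal_casimir_mul N n F ((casimir_commute_lowering N n).pow_left k),
      ih]
    simp only [pow_succ', mul_assoc]

open scoped Matrix.Norms.Operator in
theorem hasSum_trace_mul_exp (D X : Op N n) (b : ℂ) :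
    HasSum (fun k : ℕ => ((k.factorial : ℂ))⁻¹ * (b ^ k * (D * X ^ k).trace))
      (D * NormedSpace.exp (b • X)).trace := by
  have := hasSum_clm_exp (A := Op N n) (LinearMap.toContinuousLinearMap
    ((Matrix.traceLinearMap _ ℂ ℂ).comp (LinearMap.mulLeft ℂ D))) b X
  exact this

theorem trace_magDiagonal_exp_casimir (F : ℝ → ℂ) (b : ℂ) :
    (magDiagonal N n (backDiff F) * NormedSpace.exp (b • casimir N n)).trace =
      ∑ σ : Fin n → Fin (N + 1),
        backDiff (fun M => F M * Complex.exp (b * ((M * (M + 1) : ℝ) : ℂ))) (magnetization σ) := by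
  refine (hasSum_trace_mul_exp N n _ _ b).unique ?_
  simp only [trace_magDiagonal_casimir_pow, Finset.mul_sum]
  refine hasSum_sum fun σ _ => ?_
  have hexp : ∀ z : ℂ, HasSum (fun k : ℕ => ((k.factorial : ℂ))⁻¹ * z ^ k) (Complex.exp z) := by
    intro z
    rw [Complex.exp_eq_exp_ℂ]
    simpa using NormedSpace.exp_series_hasSum_exp' (𝕂 := ℂ) z
  unfold backDiff
  have h := ((hexp (b * ((magnetization σ * (magnetization σ + 1) : ℝ) : ℂ))).mul_left
    (F (magnetization σ))).sub ((hexp (b * (((magnetization σ - 1) * (magnetization σ - 1 + 1) : ℝ)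
      : ℂ))).mul_left (F (magnetization σ - 1)))
  refine Eq.subst (motive := fun f : ℕ → ℂ => HasSum f _) (funext fun k => ?_) h
  simp only [mul_pow]
  ring

end Trace

end SpinSystem

namespace SpinSystem

open Matrix

section Gibbs

variable (N n : ℕ)

open scoped Matrix.Norms.Operator in
theorem exists_rotation : ∃ U V : Op N n, U * V = 1 ∧ V * U = 1 ∧
    U * total n (spin1 N) * V = total n (spin3 N) ∧ Commute U (casimir N n) := by
  have h1 := total_spin3_mul_raising N n
  have h2 := total_spin3_mul_lowering N n
  have h3 := total_raising_mul_lowering N n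
  have c1 := casimir_commute_raising N n
  have c2 := casimir_commute_lowering N n
  have hT : total n (spin1 N) = (1 / 2 : ℂ) • (total n (raising N) + total n (raising N)ᴴ) := by
    rw [spin1, total_smul, total_add]
  rw [hT]
  generalize total n (raising N) = P at *
  generalize total n (raising N)ᴴ = M at *
  generalize total n (spin3 N) = Z at *
  generalize casimir N n = X at *
  have e1 : ((1 / 2 : ℂ) • (P - M)) * ((1 / 2 : ℂ) • (P + M))
      - ((1 / 2 : ℂ) • (P + M)) * ((1 / 2 : ℂ) • (P - M)) = Z := by
    rw [smul_mul_smul_comm, smul_mul_smul_comm, ← smul_sub]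
    have : (P - M) * (P + M) - (P + M) * (P - M) = (2 : ℂ) • (P * M - M * P) := by
      rw [two_smul]; noncomm_ring
    rw [this, h3]
    module
  have e2 : ((1 / 2 : ℂ) • (P - M)) * Z - Z * ((1 / 2 : ℂ) • (P - M)) =
      -((1 / 2 : ℂ) • (P + M)) := by
    rw [smul_mul_assoc, mul_smul_comm, ← smul_sub, mul_sub, sub_mul, h1, h2, ← smul_neg]
    congr 1
    abel
  obtain ⟨U, V, hU, hV, hUV, hc⟩ := exp_rotation (A := Op N n) e1 e2
  exact ⟨U, V, hU, hV, hUV, hc X ((c1.symm.sub_left c2.symm).smul_left _)⟩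

theorem exp_smul_total_spin3 (z : ℂ) : NormedSpace.exp (z • total n (spin3 N)) =
    magDiagonal N n fun M => Complex.exp (z * (M : ℂ)) := by
  rw [total_spin3, ← diagonal_smul, exp_diagonal, magDiagonal]
  congr 1
  funext σ
  rw [Pi.coe_exp, Complex.exp_eq_exp_ℂ]
  rfl

theorem trace_exp_total_spin1 (z b : ℂ) :
    (NormedSpace.exp (z • total n (spin1 N)) * NormedSpace.exp (b • casimir N n)).trace =
      (magDiagonal N n (fun M => Complex.exp (z * (M : ℂ))) *
        NormedSpace.exp (b • casimir N n)).trace := by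
  obtain ⟨U, V, hU, hV, hUV, hc⟩ := exists_rotation N n
  have h := exp_units_conj (⟨U, V, hU, hV⟩ : (Op N n)ˣ) (z • total n (spin1 N))
  simp only [Units.val_mk, Units.inv_mk, mul_smul_comm, smul_mul_assoc, hUV] at h
  rw [← exp_smul_total_spin3, h]
  have hc' : Commute U (NormedSpace.exp (b • casimir N n)) := (hc.smul_right b).exp_right
  symm
  calc _ = (U * (NormedSpace.exp (z • total n (spin1 N)) * V *
        NormedSpace.exp (b • casimir N n))).trace := by simp only [mul_assoc]
    _ = (NormedSpace.exp (z • total n (spin1 N)) * V *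
        (NormedSpace.exp (b • casimir N n) * U)).trace := by rw [trace_mul_comm, mul_assoc]
    _ = (NormedSpace.exp (z • total n (spin1 N)) * (V * U) *
        NormedSpace.exp (b • casimir N n)).trace := by rw [← hc'.eq]; simp only [mul_assoc]
    _ = _ := by rw [hV, mul_one]

theorem exp_smul_heisenberg (hn : n ≠ 0) (β : ℝ) :
    ∃ c : ℂ, c ≠ 0 ∧ NormedSpace.exp ((-(β : ℂ)) • heisenberg N n 1) =
      c • NormedSpace.exp (((β / n : ℝ) : ℂ) • casimir N n) := by
  refine ⟨Complex.exp ((-(β * (spin N * (spin N + 1))) : ℝ) : ℂ), Complex.exp_ne_zero _, ?_⟩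
  rw [heisenberg_eq N n hn, exp_add_of_commute _ _ ((Commute.one_right _).smul_right _)]
  have h : NormedSpace.exp (((-(β * (spin N * (spin N + 1))) : ℝ) : ℂ) • (1 : Op N n)) =
      Complex.exp ((-(β * (spin N * (spin N + 1))) : ℝ) : ℂ) • 1 := by
    rw [← diagonal_one, ← diagonal_smul, exp_diagonal, ← diagonal_smul]
    congr 1
    funext σ
    rw [Pi.coe_exp, Complex.exp_eq_exp_ℂ]
    simp
  rw [h, mul_smul_comm, mul_one]

theorem gibbs_exp_total_spin1 (hn : n ≠ 0) (β : ℝ) (z : ℂ) :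
    gibbs N n β 1 (NormedSpace.exp (z • ∑ i : Fin n, atSite (spin1 N) i)) =
      (magDiagonal N n (fun M => Complex.exp (z * (M : ℂ))) *
        NormedSpace.exp (((β / n : ℝ) : ℂ) • casimir N n)).trace /
      (NormedSpace.exp (((β / n : ℝ) : ℂ) • casimir N n)).trace := by
  obtain ⟨c, hc, h⟩ := exp_smul_heisenberg N n hn β
  rw [gibbs, h, mul_smul_comm, trace_smul, trace_smul, smul_eq_mul, smul_eq_mul,
    mul_div_mul_left _ _ hc, ← trace_exp_total_spin1, total]

end Gibbs

theorem sinh_eq_mul_sinhc (z : ℂ) : Complex.sinh z = z * sinhc z := by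
  unfold sinhc
  split_ifs with h
  · simp [h]
  · field_simp

section Counting

variable (N : ℕ)

/-- Twice the magnetization, an integer. -/
def twiceMag {N n : ℕ} (σ : Fin n → Fin (N + 1)) : ℤ := ∑ i, (2 * (σ i : ℤ) - N)

theorem twiceMag_eq {N n : ℕ} (σ : Fin n → Fin (N + 1)) :
    (twiceMag σ : ℝ) = 2 * magnetization σ := by
  unfold twiceMag magnetization weight spin
  push_cast
  rw [Finset.mul_sum]
  exact Finset.sum_congr rfl fun i _ => by ring

theorem abs_twiceMag_le {N n : ℕ} (σ : Fin n → Fin (N + 1)) : |twiceMag σ| ≤ n * N := by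
  unfold twiceMag
  refine (Finset.abs_sum_le_sum_abs _ _).trans ?_
  refine (Finset.sum_le_card_nsmul _ _ (N : ℤ) fun i _ => ?_).trans (by simp)
  have := (σ i).2
  rw [abs_le]; omega

/-- The number of configurations with twice the magnetization `t - 1`, minus the number of those
with `t + 1`; for `t ≥ 1` it is the multiplicity of the irreducible representation of dimension `t`
in the `n`-fold tensor power. -/
def multiplicity (n : ℕ) (t : ℤ) : ℤ := ∑ σ : Fin n → Fin (N + 1),
  ((if t = twiceMag σ + 1 then 1 else 0) - (if t = twiceMag σ - 1 then 1 else 0))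

theorem multiplicity_zero (t : ℤ) :
    multiplicity N 0 t = (if t = 1 then 1 else 0) - (if t = -1 then 1 else 0) := by
  simp [multiplicity, twiceMag]

theorem multiplicity_succ (n : ℕ) (t : ℤ) : multiplicity N (n + 1) t =
    ∑ a ∈ Finset.range (N + 1), multiplicity N n (t + N - 2 * a) := by
  rw [← Fin.sum_univ_eq_sum_range (fun a : ℕ => multiplicity N n (t + N - 2 * a))]
  unfold multiplicity
  rw [← (Fin.consEquiv (fun _ : Fin (n + 1) => Fin (N + 1))).sum_comp, Fintype.sum_prod_type]
  refine Finset.sum_congr rfl fun a _ => Finset.sum_congr rfl fun σ _ => ?_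
  have h : twiceMag ((Fin.consEquiv (fun _ : Fin (n + 1) => Fin (N + 1))) (a, σ)) =
      2 * (a : ℤ) - N + twiceMag σ := by
    simp [twiceMag, Fin.consEquiv, Fin.sum_univ_succ]
    ring
  rw [h]
  congr 1
  · exact if_congr (by constructor <;> intro h <;> linarith) rfl rfl
  · exact if_congr (by constructor <;> intro h <;> linarith) rfl rfl

theorem sum_window_eq_zero {c : ℤ → ℤ} (hc : ∀ t, c (-t) = -c t) (K : ℕ) :
    ∑ a ∈ Finset.range (K + 1), c (K - 2 * a) = 0 := by
  have h : ∑ a ∈ Finset.range (K + 1), c (K - 2 * a) =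
      -∑ a ∈ Finset.range (K + 1), c (K - 2 * a) := by
    conv_lhs => rw [← Finset.sum_range_reflect]
    rw [← Finset.sum_neg_distrib]
    refine Finset.sum_congr rfl fun a ha => ?_
    have ha : a ≤ K := Nat.lt_succ_iff.1 (Finset.mem_range.1 ha)
    rw [← hc]
    congr 1
    rw [show K + 1 - 1 - a = K - a by omega, Nat.cast_sub ha]
    ring
  linarith

theorem sum_window_nonneg {c : ℤ → ℤ} (hc : ∀ t, c (-t) = -c t) (hc0 : ∀ t, 0 ≤ t → 0 ≤ c t)
    (t : ℕ) : 0 ≤ ∑ a ∈ Finset.range (N + 1), c (t + N - 2 * a) := by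
  rcases le_or_gt N t with h | h
  · refine Finset.sum_nonneg fun a ha => hc0 _ ?_
    have := Finset.mem_range.1 ha
    omega
  · obtain ⟨K, rfl⟩ := Nat.exists_eq_add_of_le h.le
    rw [show t + K + 1 = t + (K + 1) by ring, Finset.sum_range_add]
    have h0 : ∑ a ∈ Finset.range (K + 1), c (t + (t + K : ℕ) - 2 * (t + a : ℕ)) = 0 := by
      rw [← sum_window_eq_zero hc K]
      refine Finset.sum_congr rfl fun a _ => ?_
      congr 1; push_cast; ring
    rw [h0, add_zero]
    refine Finset.sum_nonneg fun a ha => hc0 _ ?_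
    have := Finset.mem_range.1 ha
    omega

theorem multiplicity_neg (n : ℕ) (t : ℤ) : multiplicity N n (-t) = -multiplicity N n t := by
  induction n generalizing t with
  | zero =>
    rw [multiplicity_zero, multiplicity_zero]
    split_ifs <;> omega
  | succ n ih =>
    rw [multiplicity_succ, multiplicity_succ, ← Finset.sum_range_reflect, ← Finset.sum_neg_distrib]
    refine Finset.sum_congr rfl fun a ha => ?_
    have ha : a ≤ N := Nat.lt_succ_iff.1 (Finset.mem_range.1 ha)
    rw [← ih]
    congr 1
    rw [show N + 1 - 1 - a = N - a by omega, Nat.cast_sub ha]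
    ring

theorem multiplicity_nonneg (n : ℕ) {t : ℤ} (ht : 0 ≤ t) : 0 ≤ multiplicity N n t := by
  induction n generalizing t with
  | zero =>
    rw [multiplicity_zero]
    split_ifs <;> omega
  | succ n ih =>
    rw [multiplicity_succ]
    lift t to ℕ using ht
    exact sum_window_nonneg N (multiplicity_neg N n) (fun t ht => ih ht) t

theorem multiplicity_mul_nonneg (n : ℕ) (t : ℤ) : 0 ≤ multiplicity N n t * t := by
  rcases le_total 0 t with h | h
  · exact mul_nonneg (multiplicity_nonneg N n h) h
  · have := multiplicity_nonneg N n (neg_nonneg.2 h)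
    rw [multiplicity_neg] at this
    exact mul_nonneg_of_nonpos_of_nonpos (by linarith) h

/-- The integers that can occur as `2J + 1` up to sign. -/
def dims (n : ℕ) : Finset ℤ := Finset.Icc (-(n * N + 1 : ℤ)) (n * N + 1)

theorem sum_multiplicity_mul {R : Type*} [CommRing R] (n : ℕ) (G : ℤ → R) :
    ∑ t ∈ dims N n, (multiplicity N n t : R) * G t =
      ∑ σ : Fin n → Fin (N + 1), (G (twiceMag σ + 1) - G (twiceMag σ - 1)) := by
  unfold multiplicity
  push_cast
  simp only [Finset.sum_mul, sub_mul, ite_mul, one_mul, zero_mul]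
  rw [Finset.sum_comm]
  refine Finset.sum_congr rfl fun σ _ => ?_
  have h := abs_le.1 (abs_twiceMag_le σ)
  rw [Finset.sum_sub_distrib, Finset.sum_ite_eq', Finset.sum_ite_eq', if_pos, if_pos]
  · rw [dims, Finset.mem_Icc]; constructor <;> linarith
  · rw [dims, Finset.mem_Icc]; constructor <;> linarith

theorem sum_dims_neg {R : Type*} [AddCommMonoid R] (n : ℕ) (G : ℤ → R) :
    ∑ t ∈ dims N n, G (-t) = ∑ t ∈ dims N n, G t := by
  refine Finset.sum_nbij' (fun t => -t) (fun t => -t) ?_ ?_ ?_ ?_ ?_ <;>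
    simp only [dims, Finset.mem_Icc, neg_neg, implies_true] <;> intro t ht <;> constructor <;>
    linarith [ht.1, ht.2]

/-- The contribution to the partition function of the irreducible representations of
dimension `|t|`, each of `t` and `-t` carrying one half of it. -/
def gibbsWeight (n : ℕ) (b : ℝ) (t : ℤ) : ℝ :=
  multiplicity N n t * (t / 2) * Real.exp (b * ((t ^ 2 - 1) / 4))

theorem gibbsWeight_nonneg (n : ℕ) (b : ℝ) (t : ℤ) : 0 ≤ gibbsWeight N n b t := by
  have : (0 : ℝ) ≤ (multiplicity N n t * t : ℤ) := by exact_mod_cast multiplicity_mul_nonneg N n t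
  push_cast at this
  unfold gibbsWeight
  rw [← mul_div_assoc]
  positivity

theorem sum_backDiff (n : ℕ) (F : ℝ → ℂ) (b : ℝ) :
    (magDiagonal N n (backDiff F) * NormedSpace.exp ((b : ℂ) • casimir N n)).trace =
      ∑ t ∈ dims N n, (multiplicity N n t : ℂ) *
        (F ((t - 1) / 2) * ((Real.exp (b * ((t ^ 2 - 1) / 4)) : ℝ) : ℂ)) := by
  rw [trace_magDiagonal_exp_casimir, sum_multiplicity_mul]
  refine Finset.sum_congr rfl fun σ _ => ?_
  have h := twiceMag_eq σ
  have e1 : (((twiceMag σ + 1 : ℤ) : ℝ) - 1) / 2 = magnetization σ := by push_cast; linarith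
  have e2 : (((twiceMag σ - 1 : ℤ) : ℝ) - 1) / 2 = magnetization σ - 1 := by push_cast; linarith
  have e3 : (((twiceMag σ + 1 : ℤ) : ℝ) ^ 2 - 1) / 4 = magnetization σ * (magnetization σ + 1) := by
    push_cast; rw [h]; ring
  have e4 : (((twiceMag σ - 1 : ℤ) : ℝ) ^ 2 - 1) / 4 =
      (magnetization σ - 1) * (magnetization σ - 1 + 1) := by
    push_cast; rw [h]; ring
  rw [e1, e2, e3, e4]
  simp only [backDiff, Complex.ofReal_exp, Complex.ofReal_mul]

theorem trace_exp_casimir (n : ℕ) (b : ℝ) :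
    (NormedSpace.exp ((b : ℂ) • casimir N n)).trace =
      ((∑ t ∈ dims N n, gibbsWeight N n b t : ℝ) : ℂ) := by
  have h := sum_backDiff N n (fun M => (M : ℂ) + 1 / 2) b
  have h1 : magDiagonal N n (backDiff fun M => (M : ℂ) + 1 / 2) = 1 := by
    rw [← diagonal_one, magDiagonal]
    congr 1; funext σ
    simp only [backDiff]; push_cast; ring
  rw [h1, one_mul] at h
  rw [h]
  push_cast
  refine Finset.sum_congr rfl fun t _ => ?_
  simp only [gibbsWeight]
  push_cast
  ring

theorem sinhc_mul_trace_exp (n : ℕ) (b : ℝ) (z : ℂ) :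
    sinhc (z / 2) * (magDiagonal N n (fun M => Complex.exp (z * (M : ℂ))) *
        NormedSpace.exp ((b : ℂ) • casimir N n)).trace =
      ∑ t ∈ dims N n, (gibbsWeight N n b t : ℂ) * sinhc (z * t / 2) := by
  by_cases hz : z = 0
  · subst hz
    have h1 : magDiagonal N n (fun M => Complex.exp (0 * (M : ℂ))) = 1 := by
      simp [magDiagonal]
    rw [h1, one_mul, trace_exp_casimir]
    simp [sinhc]
  have h := sum_backDiff N n (fun M => Complex.exp (z * (M + 1 / 2))) b
  have h1 : magDiagonal N n (backDiff fun M => Complex.exp (z * ((M : ℂ) + 1 / 2))) =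
      (2 * Complex.sinh (z / 2)) • magDiagonal N n (fun M => Complex.exp (z * (M : ℂ))) := by
    rw [magDiagonal, magDiagonal, ← diagonal_smul]
    congr 1; funext σ
    simp only [backDiff, Pi.smul_apply, smul_eq_mul]
    rw [Complex.sinh, mul_div_cancel₀ _ two_ne_zero, sub_mul, ← Complex.exp_add, ← Complex.exp_add]
    congr 2 <;> push_cast <;> ring
  rw [h1, smul_mul_assoc, trace_smul, smul_eq_mul] at h
  set T := (magDiagonal N n (fun M => Complex.exp (z * (M : ℂ))) *
        NormedSpace.exp ((b : ℂ) • casimir N n)).trace with hT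
  have h2 : ∑ t ∈ dims N n, (multiplicity N n t : ℂ) * (Complex.exp (z * ((((t : ℝ) - 1) / 2 : ℝ) + 1 / 2)) *
      ((Real.exp (b * ((t ^ 2 - 1) / 4)) : ℝ) : ℂ)) = ∑ t ∈ dims N n, -(multiplicity N n t : ℂ) *
      (Complex.exp (-(z * t / 2)) * ((Real.exp (b * ((t ^ 2 - 1) / 4)) : ℝ) : ℂ)) := by
    rw [← sum_dims_neg]
    refine Finset.sum_congr rfl fun t _ => ?_
    rw [multiplicity_neg]
    push_cast
    rw [neg_sq]
    congr 3; ring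
  have h3 : 2 * (2 * Complex.sinh (z / 2) * T) = ∑ t ∈ dims N n, (multiplicity N n t : ℂ) *
      (2 * Complex.sinh (z * t / 2) * ((Real.exp (b * ((t ^ 2 - 1) / 4)) : ℝ) : ℂ)) := by
    rw [two_mul]
    nth_rewrite 2 [h]
    rw [h2, h, ← Finset.sum_add_distrib]
    refine Finset.sum_congr rfl fun t _ => ?_
    rw [Complex.sinh, mul_div_cancel₀ _ two_ne_zero]
    have : z * ((((t : ℝ) - 1) / 2 : ℝ) + 1 / 2) = z * t / 2 := by push_cast; ring
    rw [this]
    ring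
  have h4 : 2 * z * (sinhc (z / 2) * T) = 2 * z * ∑ t ∈ dims N n, (gibbsWeight N n b t : ℂ) *
      sinhc (z * t / 2) := by
    have : 2 * z * (sinhc (z / 2) * T) = 2 * (2 * Complex.sinh (z / 2) * T) := by
      rw [sinh_eq_mul_sinhc]; ring
    rw [this, h3, Finset.mul_sum]
    refine Finset.sum_congr rfl fun t _ => ?_
    rw [sinh_eq_mul_sinhc, gibbsWeight]
    push_cast
    ring
  exact mul_left_cancel₀ (mul_ne_zero two_ne_zero hz) h4

end Counting

end SpinSystem

namespace SpinSystem

open Filter Topology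

section Asymptotics

variable (N : ℕ)

theorem sum_exp_magnetization (n : ℕ) (x : ℝ) :
    ∑ σ : Fin n → Fin (N + 1), Real.exp (x * magnetization σ) = Real.exp (n * eta N x) := by
  rw [mul_comm, Real.exp_mul, exp_eta, Real.rpow_natCast, expMoment, Fintype.sum_pow]
  refine Finset.sum_congr rfl fun σ _ => ?_
  simp only [magnetization, Finset.mul_sum, Real.exp_sum, pow_zero, one_mul]

theorem sum_magnetization (n : ℕ) : ∑ σ : Fin n → Fin (N + 1), magnetization σ = 0 := by
  have hinv : Function.Involutive fun (σ : Fin n → Fin (N + 1)) i => (σ i).rev := fun σ => by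
    funext i; simp
  have h := Equiv.sum_comp (hinv.toPerm _) (magnetization (N := N) (n := n))
  have h2 : ∀ σ : Fin n → Fin (N + 1), magnetization (hinv.toPerm _ σ) = -magnetization σ := by
    intro σ
    simp [magnetization, weight_rev]
  simp only [h2, Finset.sum_neg_distrib] at h
  linarith

/-- The Chernoff bound for the multiplicities. -/
theorem abs_multiplicity_le (n : ℕ) (t : ℤ) (x : ℝ) : |(multiplicity N n t : ℝ)| ≤
    2 * Real.exp (n * eta N x - x * (t / 2) + |x| / 2) := by
  have key : ∀ (σ : Fin n → Fin (N + 1)) (u : ℤ) (ε : ℝ), |ε| = 1 → (u : ℝ) = twiceMag σ + ε →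
      (1 : ℝ) ≤ Real.exp (x * magnetization σ) * Real.exp (-(x * (u / 2)) + |x| / 2) := by
    intro σ u ε hε hu
    rw [← Real.exp_add, Real.one_le_exp_iff, hu, twiceMag_eq]
    have : x * ε ≤ |x| := (le_abs_self _).trans (by rw [abs_mul, hε, mul_one])
    linarith
  have hsplit : (2 : ℝ) * Real.exp (n * eta N x - x * (t / 2) + |x| / 2) =
      ∑ σ : Fin n → Fin (N + 1), 2 * (Real.exp (x * magnetization σ) *
        Real.exp (-(x * (t / 2)) + |x| / 2)) := by
    rw [← Finset.mul_sum, ← Finset.sum_mul, sum_exp_magnetization, ← Real.exp_add]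
    ring_nf
  rw [hsplit, multiplicity]
  push_cast
  refine (Finset.abs_sum_le_sum_abs _ _).trans (Finset.sum_le_sum fun σ _ => ?_)
  have hpos : 0 < Real.exp (x * magnetization σ) * Real.exp (-(x * (t / 2)) + |x| / 2) := by
    positivity
  split_ifs with h1 h2 h2
  · simp [hpos.le]
  · have := key σ t 1 (by simp) (by rw [h1]; push_cast; ring)
    norm_num; linarith
  · have := key σ t (-1) (by simp) (by rw [h2]; push_cast; ring)
    norm_num; linarith
  · simp [hpos.le]

theorem abs_le_of_mem_dims {n : ℕ} (hn : n ≠ 0) {t : ℤ} (ht : t ∈ dims N n) :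
    |(t : ℝ)| ≤ n * (N + 1) := by
  rw [dims, Finset.mem_Icc] at ht
  have h1 : |t| ≤ n * N + 1 := abs_le.2 ⟨by linarith [ht.1], ht.2⟩
  have h2 : (1 : ℤ) ≤ n := by exact_mod_cast Nat.one_le_iff_ne_zero.2 hn
  have h3 : |t| ≤ n * (N + 1) := by linarith
  exact_mod_cast h3

theorem card_dims_le {n : ℕ} (hn : n ≠ 0) : ((dims N n).card : ℝ) ≤ n * (2 * N + 3) := by
  have h : ((dims N n).card : ℤ) = 2 * (n * N) + 3 := by
    rw [dims, Int.card_Icc, Int.toNat_of_nonneg]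
    · ring
    · have : (0 : ℤ) ≤ n * N := by positivity
      linarith
  have h' : ((dims N n).card : ℝ) = 2 * (n * N) + 3 := by exact_mod_cast h
  have : (1 : ℝ) ≤ n := by exact_mod_cast Nat.one_le_iff_ne_zero.2 hn
  rw [h']; nlinarith

theorem gibbsWeight_le {n : ℕ} (hn : n ≠ 0) {t : ℤ} (ht : t ∈ dims N n) (b x : ℝ) :
    gibbsWeight N n b t ≤ n * (N + 1) *
      Real.exp (n * eta N x - x * (t / 2) + |x| / 2 + b * ((t ^ 2 - 1) / 4)) := by
  have h1 := abs_multiplicity_le N n t x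
  have h2 := abs_le_of_mem_dims N hn ht
  rw [gibbsWeight, Real.exp_add, ← mul_assoc]
  refine mul_le_mul_of_nonneg_right ?_ (Real.exp_pos _).le
  calc (multiplicity N n t : ℝ) * (t / 2) ≤ |(multiplicity N n t : ℝ)| * (|(t : ℝ)| / 2) := by
        refine (le_abs_self _).trans ?_
        rw [abs_mul, abs_div, abs_two]
    _ ≤ (2 * Real.exp (n * eta N x - x * (t / 2) + |x| / 2)) * (n * (N + 1) / 2) := by gcongr
    _ = _ := by ring

/-- The normalised spin lengths away from `m`. -/
def awayFrom (n : ℕ) (m δ : ℝ) : Finset ℤ :=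
  (dims N n).filter fun t => δ ≤ |(|(t : ℝ) / (2 * n)| - m)|

theorem tendsto_tail {β m δ Λ ε C c : ℝ} (hε : 0 < ε) (hc : 0 < c)
    (hupper : ∀ n : ℕ, n ≠ 0 → ∀ t ∈ awayFrom N n m δ,
      gibbsWeight N n (β / n) t ≤ n * C * Real.exp (n * (Λ - ε)))
    (hlower : ∀ᶠ n : ℕ in atTop, c * Real.exp (n * (Λ - ε / 2)) ≤
      ∑ t ∈ dims N n, gibbsWeight N n (β / n) t) :
    Tendsto (fun n : ℕ => (∑ t ∈ awayFrom N n m δ, gibbsWeight N n (β / n) t) /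
      ∑ t ∈ dims N n, gibbsWeight N n (β / n) t) atTop (𝓝 0) := by
  have hlim : Tendsto (fun n : ℕ => (2 * N + 3) * |C| / c * ((n : ℝ) ^ 2 *
      Real.exp (-(ε / 2) * n))) atTop (𝓝 0) := by
    have h := (tendsto_rpow_mul_exp_neg_mul_atTop_nhds_zero 2 (ε / 2) (half_pos hε)).comp
      (tendsto_natCast_atTop_atTop (R := ℝ))
    have h2 := h.const_mul ((2 * N + 3) * |C| / c)
    rw [mul_zero] at h2
    refine h2.congr fun n => ?_
    simp
  refine squeeze_zero' (Eventually.of_forall fun n => ?_) ?_ hlim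
  · exact div_nonneg (Finset.sum_nonneg fun t _ => gibbsWeight_nonneg N n _ t)
      (Finset.sum_nonneg fun t _ => gibbsWeight_nonneg N n _ t)
  · filter_upwards [hlower, eventually_ne_atTop 0] with n hn hn0
    have hnum : ∑ t ∈ awayFrom N n m δ, gibbsWeight N n (β / n) t ≤
        n * (2 * N + 3) * (n * |C| * Real.exp (n * (Λ - ε))) := by
      refine (Finset.sum_le_card_nsmul _ _ (n * |C| * Real.exp (n * (Λ - ε))) fun t ht => ?_).trans ?_
      · refine (hupper n hn0 t ht).trans ?_
        gcongr
        exact le_abs_self C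
      · rw [nsmul_eq_mul]
        gcongr
        exact le_trans (by exact_mod_cast Finset.card_filter_le _ _) (card_dims_le N hn0)
    refine (div_le_div₀ (by positivity) hnum (by positivity) hn).trans (le_of_eq ?_)
    have : Real.exp (n * (Λ - ε)) = Real.exp (n * (Λ - ε / 2)) * Real.exp (-(ε / 2) * n) := by
      rw [← Real.exp_add]; ring_nf
    rw [this]
    field_simp

theorem exists_freeEnergy_gap {N : ℕ} (hN : 1 ≤ N) {β : ℝ} (hβ : 0 < β) (K : ℝ) {δ : ℝ}
    (hδ : 0 < δ) : ∃ ε > 0, ∀ s : ℝ, |s| ≤ K → δ ≤ |(|s| - mStar N β)| →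
      freeEnergy N β s ≤ freeEnergy N β (mStar N β) - ε := by
  have hcl : IsClosed {s : ℝ | δ ≤ |(|s| - mStar N β)|} :=
    isClosed_le continuous_const (by fun_prop)
  have hcomp : IsCompact (Set.Icc (-K) K ∩ {s : ℝ | δ ≤ |(|s| - mStar N β)|}) :=
    isCompact_Icc.inter_right hcl
  rcases Set.eq_empty_or_nonempty (Set.Icc (-K) K ∩ {s : ℝ | δ ≤ |(|s| - mStar N β)|}) with h | h
  · refine ⟨1, one_pos, fun s hs hs' => ?_⟩
    exact absurd (show s ∈ Set.Icc (-K) K ∩ {s : ℝ | δ ≤ |(|s| - mStar N β)|} from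
      ⟨abs_le.1 hs, hs'⟩) (by rw [h]; exact Set.notMem_empty s)
  · obtain ⟨s₀, hs₀, hmax⟩ := hcomp.exists_isMaxOn h (continuous_freeEnergy N β).continuousOn
    have hne : |s₀| ≠ mStar N β := fun h0 => by
      have := hs₀.2
      rw [Set.mem_ofPred_eq, h0, sub_self, abs_zero] at this
      linarith
    refine ⟨freeEnergy N β (mStar N β) - freeEnergy N β s₀,
      sub_pos.2 (freeEnergy_lt_mStar hN hβ hne), fun s hs hs' => ?_⟩
    have : freeEnergy N β s ≤ freeEnergy N β s₀ := hmax ⟨abs_le.1 hs, hs'⟩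
    linarith

theorem abs_div_le_of_mem_dims {n : ℕ} (hn : n ≠ 0) {t : ℤ} (ht : t ∈ dims N n) :
    |(t : ℝ) / (2 * n)| ≤ (N + 1) / 2 := by
  have hn' : (0 : ℝ) < n := by exact_mod_cast Nat.pos_of_ne_zero hn
  rw [abs_div, abs_of_pos (show (0 : ℝ) < 2 * n by positivity), div_le_div_iff₀ (by positivity) two_pos]
  have := abs_le_of_mem_dims N hn ht
  linarith

theorem sum_gibbsWeight_ge {n : ℕ} (hn : n ≠ 0) {β m : ℝ} (hβ : 0 ≤ β) (hm : 0 ≤ m) :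
    Real.exp (-(β / 4)) * Real.exp (n * freeEnergy N β m) ≤
      ∑ t ∈ dims N n, gibbsWeight N n (β / n) t := by
  have hn' : (1 : ℝ) ≤ n := by exact_mod_cast Nat.one_le_iff_ne_zero.2 hn
  have hn0 : (0 : ℝ) < n := by linarith
  have hx : 0 ≤ 2 * β * m := by positivity
  have h1 : Real.exp (n * eta N (2 * β * m)) ≤
      ∑ t ∈ dims N n, (multiplicity N n t : ℝ) * ((t / 2) * Real.exp (2 * β * m * (t / 2))) := by
    rw [sum_multiplicity_mul]
    generalize 2 * β * m = x at hx
    have e : ∀ σ : Fin n → Fin (N + 1), magnetization σ * (2 * Real.sinh (x / 2)) +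
        Real.exp (x * magnetization σ) ≤ (((twiceMag σ + 1 : ℤ) : ℝ) / 2) *
        Real.exp (x * (((twiceMag σ + 1 : ℤ) : ℝ) / 2)) - (((twiceMag σ - 1 : ℤ) : ℝ) / 2) *
        Real.exp (x * (((twiceMag σ - 1 : ℤ) : ℝ) / 2)) := by
      intro σ
      push_cast
      rw [twiceMag_eq]
      generalize magnetization σ = M
      rw [show x * ((2 * M + 1) / 2) = x * M + x / 2 by ring,
        show x * ((2 * M - 1) / 2) = x * M + -(x / 2) by ring, Real.exp_add, Real.exp_add]
      have e1 : (2 * M + 1) / 2 * (Real.exp (x * M) * Real.exp (x / 2)) -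
          (2 * M - 1) / 2 * (Real.exp (x * M) * Real.exp (-(x / 2))) =
          M * Real.exp (x * M) * (2 * Real.sinh (x / 2)) + Real.exp (x * M) * Real.cosh (x / 2) := by
        rw [Real.sinh_eq, Real.cosh_eq]; ring
      rw [e1]
      have h2 : M ≤ M * Real.exp (x * M) := by
        rcases le_total 0 M with h | h
        · exact le_mul_of_one_le_right h (Real.one_le_exp (mul_nonneg hx h))
        · have : Real.exp (x * M) ≤ 1 := Real.exp_le_one_iff.2 (mul_nonpos_of_nonneg_of_nonpos hx h)
          nlinarith
      have h3 : 0 ≤ 2 * Real.sinh (x / 2) := by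
        have := Real.sinh_nonneg_iff.2 (show 0 ≤ x / 2 by linarith)
        positivity
      exact add_le_add (mul_le_mul_of_nonneg_right h2 h3)
        (le_mul_of_one_le_right (Real.exp_pos _).le (Real.one_le_cosh _))
    refine le_trans (le_of_eq ?_) (Finset.sum_le_sum fun σ _ => e σ)
    rw [Finset.sum_add_distrib, ← Finset.sum_mul, sum_magnetization, zero_mul, zero_add,
      sum_exp_magnetization]
  have h2 : Real.exp (-(β / 4)) * Real.exp (n * freeEnergy N β m) ≤
      Real.exp (-(β / 4) - n * (β * m ^ 2)) * ∑ t ∈ dims N n, (multiplicity N n t : ℝ) *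
        ((t / 2) * Real.exp (2 * β * m * (t / 2))) := by
    refine le_trans (le_of_eq ?_) (mul_le_mul_of_nonneg_left h1 (Real.exp_pos _).le)
    rw [← Real.exp_add, ← Real.exp_add, freeEnergy]
    ring_nf
  refine h2.trans ?_
  rw [Finset.mul_sum]
  refine Finset.sum_le_sum fun t _ => ?_
  have hnn : (0 : ℝ) ≤ multiplicity N n t * (t / 2) := by
    have : (0 : ℝ) ≤ (multiplicity N n t * t : ℤ) := by
      exact_mod_cast multiplicity_mul_nonneg N n t
    push_cast at this
    linarith
  rw [gibbsWeight, ← mul_assoc (multiplicity N n t : ℝ), mul_left_comm, ← Real.exp_add]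
  refine mul_le_mul_of_nonneg_left (Real.exp_le_exp.2 ?_) hnn
  have e2 : β / n * ((t ^ 2 - 1) / 4) - (-(β / 4) - n * (β * m ^ 2) + 2 * β * m * (t / 2)) =
      β / n * ((t / 2 - n * m) ^ 2) + (β / 4) * (1 - 1 / n) := by
    field_simp; ring
  have h3 : 1 / (n : ℝ) ≤ 1 := by rw [div_le_one hn0]; exact hn'
  have h4 : 0 ≤ β / n * ((t / 2 - n * m) ^ 2) + (β / 4) * (1 - 1 / n) :=
    add_nonneg (by positivity) (mul_nonneg (by positivity) (by linarith))
  linarith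

theorem tendsto_tail_of_pos {N : ℕ} (hN : 1 ≤ N) {β : ℝ} (hβ : 0 < β) {δ : ℝ} (hδ : 0 < δ) :
    Tendsto (fun n : ℕ => (∑ t ∈ awayFrom N n (mStar N β) δ, gibbsWeight N n (β / n) t) /
      ∑ t ∈ dims N n, gibbsWeight N n (β / n) t) atTop (𝓝 0) := by
  obtain ⟨ε, hε, hgap⟩ := exists_freeEnergy_gap hN hβ ((N + 1) / 2) hδ
  refine tendsto_tail N (Λ := freeEnergy N β (mStar N β)) (C := (N + 1) *
    Real.exp (β * ((N + 1) / 2))) hε (Real.exp_pos (-(β / 4))) (fun n hn t ht => ?_) ?_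
  · have hn0 : (0 : ℝ) < n := by exact_mod_cast Nat.pos_of_ne_zero hn
    rw [awayFrom, Finset.mem_filter] at ht
    have hK := abs_div_le_of_mem_dims N hn ht.1
    have hg := hgap _ hK ht.2
    set s : ℝ := (t : ℝ) / (2 * n) with hs
    have ht' : (t : ℝ) = 2 * n * s := by rw [hs]; field_simp
    refine (gibbsWeight_le N hn ht.1 _ (2 * β * s)).trans ?_
    rw [← mul_assoc (n : ℝ), mul_assoc _ (Real.exp _), ← Real.exp_add]
    refine mul_le_mul_of_nonneg_left (Real.exp_le_exp.2 ?_) (by positivity)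
    rw [abs_mul, abs_of_pos (show 0 < 2 * β by positivity), ht']
    have e : n * eta N (2 * β * s) - 2 * β * s * (2 * n * s / 2) + 2 * β * |s| / 2 +
        β / n * (((2 * n * s) ^ 2 - 1) / 4) = n * freeEnergy N β s + β * |s| - β / n / 4 := by
      rw [freeEnergy]; field_simp; ring
    rw [e]
    have h1 : n * freeEnergy N β s ≤ n * (freeEnergy N β (mStar N β) - ε) := by gcongr
    have h2 : β * |s| ≤ β * ((N + 1) / 2) := by gcongr
    have h3 : 0 < β / n / 4 := by positivity
    linarith
  · filter_upwards [eventually_ne_atTop 0] with n hn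
    refine le_trans ?_ (sum_gibbsWeight_ge N hn hβ.le (mStar_nonneg hN β))
    gcongr
    linarith

theorem exists_eta_sub_lt {N : ℕ} (hN : 1 ≤ N) {δ : ℝ} (hδ : 0 < δ) :
    ∃ x > 0, eta N x - x * δ < eta N 0 := by
  have h : ∀ᶠ x in 𝓝[>] (0 : ℝ), etaDeriv N x < δ := by
    have := (continuous_etaDeriv N).tendsto 0
    rw [etaDeriv_zero] at this
    exact (this.mono_left nhdsWithin_le_nhds).eventually (gt_mem_nhds hδ)
  obtain ⟨x, hx, hx0⟩ := (h.and self_mem_nhdsWithin).exists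
  have hx0 : 0 < x := hx0
  refine ⟨x, hx0, ?_⟩
  have := eta_tangent_lt hN hx0.ne
  nlinarith

theorem tendsto_tail_of_nonpos_of_lower {N : ℕ} (hN : 1 ≤ N) {β : ℝ} (hβ : β ≤ 0) {δ : ℝ}
    (hδ : 0 < δ) {c : ℝ} (hc : 0 < c) (hlower : ∀ ε > 0, ∀ᶠ n : ℕ in atTop,
      c * Real.exp (n * (eta N 0 - ε / 2)) ≤ ∑ t ∈ dims N n, gibbsWeight N n (β / n) t) :
    Tendsto (fun n : ℕ => (∑ t ∈ awayFrom N n 0 δ, gibbsWeight N n (β / n) t) /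
      ∑ t ∈ dims N n, gibbsWeight N n (β / n) t) atTop (𝓝 0) := by
  obtain ⟨x, hx, hxδ⟩ := exists_eta_sub_lt hN hδ
  refine tendsto_tail N (Λ := eta N 0) (ε := eta N 0 - (eta N x - x * δ)) (C := (N + 1) *
    Real.exp (x / 2 - β)) (sub_pos.2 hxδ) hc (fun n hn t ht => ?_) (hlower _ (sub_pos.2 hxδ))
  have hn1 : (1 : ℝ) ≤ n := by exact_mod_cast Nat.one_le_iff_ne_zero.2 hn
  have hn0 : (0 : ℝ) < n := by linarith
  rw [awayFrom, Finset.mem_filter, sub_zero, abs_abs, abs_div,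
    abs_of_pos (show (0 : ℝ) < 2 * n by positivity), le_div_iff₀ (by positivity)] at ht
  obtain ⟨y, hy, hyt⟩ : ∃ y : ℝ, |y| = x ∧ y * t = x * |(t : ℝ)| ∧ eta N y = eta N x := by
    rcases abs_cases (t : ℝ) with ⟨h, _⟩ | ⟨h, _⟩
    · exact ⟨x, abs_of_pos hx, by rw [h], rfl⟩
    · exact ⟨-x, by rw [abs_neg, abs_of_pos hx], by rw [h]; ring, eta_neg N x⟩
  refine (gibbsWeight_le N hn ht.1 _ y).trans ?_
  rw [← mul_assoc (n : ℝ), mul_assoc _ (Real.exp _), ← Real.exp_add, hy, hyt.2]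
  refine mul_le_mul_of_nonneg_left (Real.exp_le_exp.2 ?_) (by positivity)
  have h1 : y * ((t : ℝ) / 2) ≥ n * (x * δ) := by
    have := mul_le_mul_of_nonneg_left ht.2 hx.le
    rw [← mul_div_assoc, hyt.1]; linarith
  have h2 : β / n * (((t : ℝ) ^ 2 - 1) / 4) ≤ -β := by
    have h3 : β ≤ β / n := by
      rw [le_div_iff₀ hn0]; nlinarith
    have h4 : β / n ≤ 0 := div_nonpos_of_nonpos_of_nonneg hβ hn0.le
    nlinarith [mul_nonneg (neg_nonneg.2 h4) (sq_nonneg (t : ℝ))]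
  have e : n * (eta N 0 - (eta N 0 - (eta N x - x * δ))) = n * eta N x - n * (x * δ) := by ring
  rw [e]
  linarith

theorem sum_gibbsWeight_zero (n : ℕ) :
    ∑ t ∈ dims N n, gibbsWeight N n 0 t = Real.exp (n * eta N 0) := by
  have h : ∀ t : ℤ, gibbsWeight N n 0 t = multiplicity N n t * ((t : ℝ) / 2) := fun t => by
    simp [gibbsWeight]
  simp only [h]
  rw [sum_multiplicity_mul, ← sum_exp_magnetization]
  refine Finset.sum_congr rfl fun σ _ => ?_
  push_cast
  simp only [zero_mul, Real.exp_zero]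
  ring

theorem tendsto_tail_zero {N : ℕ} (hN : 1 ≤ N) {δ : ℝ} (hδ : 0 < δ) :
    Tendsto (fun n : ℕ => (∑ t ∈ awayFrom N n 0 δ, gibbsWeight N n 0 t) /
      ∑ t ∈ dims N n, gibbsWeight N n 0 t) atTop (𝓝 0) := by
  have := tendsto_tail_of_nonpos_of_lower hN le_rfl hδ one_pos fun ε hε =>
    Eventually.of_forall fun n => by
      rw [zero_div, sum_gibbsWeight_zero, one_mul]
      gcongr
      linarith
  simpa only [zero_div] using this

theorem eventually_sum_gibbsWeight_ge {N : ℕ} (hN : 1 ≤ N) {β : ℝ} (hβ : β ≤ 0) {ε : ℝ}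
    (hε : 0 < ε) : ∀ᶠ n : ℕ in atTop, 1 / 2 * Real.exp (n * (eta N 0 - ε / 2)) ≤
      ∑ t ∈ dims N n, gibbsWeight N n (β / n) t := by
  obtain ⟨δ, hδ, hδε⟩ : ∃ δ > 0, -β * δ ^ 2 ≤ ε / 2 := by
    refine ⟨Real.sqrt (ε / 2 / (1 - β)), Real.sqrt_pos.2 (div_pos (half_pos hε) (by linarith)), ?_⟩
    rw [Real.sq_sqrt (div_nonneg (half_pos hε).le (by linarith)), mul_div_assoc',
      div_le_iff₀ (by linarith)]
    nlinarith
  filter_upwards [(tendsto_tail_zero hN hδ).eventually (gt_mem_nhds (show (0 : ℝ) < 1 / 2 by norm_num)),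
    eventually_ne_atTop 0] with n hn hn0
  have hnpos : (0 : ℝ) < n := by exact_mod_cast Nat.pos_of_ne_zero hn0
  rw [sum_gibbsWeight_zero, div_lt_iff₀ (Real.exp_pos _)] at hn
  have hsplit := Finset.sum_filter_add_sum_filter_not (dims N n)
    (fun t : ℤ => δ ≤ |(|(t : ℝ) / (2 * n)| - 0)|) (gibbsWeight N n 0)
  rw [sum_gibbsWeight_zero] at hsplit
  have hnear : 1 / 2 * Real.exp (n * eta N 0) ≤
      ∑ t ∈ (dims N n).filter (fun t : ℤ => ¬ δ ≤ |(|(t : ℝ) / (2 * n)| - 0)|),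
        gibbsWeight N n 0 t := by
    unfold awayFrom at hn
    linarith
  calc 1 / 2 * Real.exp (n * (eta N 0 - ε / 2))
      = Real.exp (-(n * (ε / 2))) * (1 / 2 * Real.exp (n * eta N 0)) := by
        rw [mul_left_comm, ← Real.exp_add]; ring_nf
    _ ≤ Real.exp (-(n * (ε / 2))) *
        ∑ t ∈ (dims N n).filter (fun t : ℤ => ¬ δ ≤ |(|(t : ℝ) / (2 * n)| - 0)|),
        gibbsWeight N n 0 t := by gcongr
    _ ≤ ∑ t ∈ (dims N n).filter (fun t : ℤ => ¬ δ ≤ |(|(t : ℝ) / (2 * n)| - 0)|),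
        gibbsWeight N n (β / n) t := by
        rw [Finset.mul_sum]
        refine Finset.sum_le_sum fun t ht => ?_
        have ht2 := (Finset.mem_filter.1 ht).2
        rw [not_le, sub_zero, abs_abs] at ht2
        have h0 := gibbsWeight_nonneg N n 0 t
        have e : gibbsWeight N n (β / n) t = gibbsWeight N n 0 t *
            Real.exp (β / n * ((t ^ 2 - 1) / 4)) := by
          simp [gibbsWeight]
        rw [e, mul_comm]
        refine mul_le_mul_of_nonneg_left (Real.exp_le_exp.2 ?_) h0
        have hs2 : ((t : ℝ) / (2 * n)) ^ 2 ≤ δ ^ 2 := by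
          rw [← sq_abs]; gcongr
        have e2 : β / n * (((t : ℝ) ^ 2 - 1) / 4) = n * (β * ((t : ℝ) / (2 * n)) ^ 2) - β / n / 4 := by
          field_simp
          ring
        have h4 : β / n ≤ 0 := div_nonpos_of_nonpos_of_nonneg hβ hnpos.le
        have h5 : -(ε / 2) ≤ β * ((t : ℝ) / (2 * n)) ^ 2 := by nlinarith
        have h6 := mul_le_mul_of_nonneg_left h5 hnpos.le
        rw [e2]; linarith
    _ ≤ _ := Finset.sum_le_sum_of_subset_of_nonneg (Finset.filter_subset _ _)
        fun t _ _ => gibbsWeight_nonneg N n _ t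

theorem tendsto_tail_mStar {N : ℕ} (hN : 1 ≤ N) (β : ℝ) {δ : ℝ} (hδ : 0 < δ) :
    Tendsto (fun n : ℕ => (∑ t ∈ awayFrom N n (mStar N β) δ, gibbsWeight N n (β / n) t) /
      ∑ t ∈ dims N n, gibbsWeight N n (β / n) t) atTop (𝓝 0) := by
  rcases lt_or_ge 0 β with hβ | hβ
  · exact tendsto_tail_of_pos hN hβ hδ
  · rw [mStar_eq (isMaximiser_zero_of_nonpos hN hβ)]
    exact tendsto_tail_of_nonpos_of_lower hN hβ hδ (show (0 : ℝ) < 1 / 2 by norm_num)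
      fun ε hε => eventually_sum_gibbsWeight_ge hN hβ hε

theorem eventually_sum_gibbsWeight_pos {N : ℕ} (hN : 1 ≤ N) (β : ℝ) :
    ∀ᶠ n : ℕ in atTop, 0 < ∑ t ∈ dims N n, gibbsWeight N n (β / n) t := by
  rcases le_total 0 β with hβ | hβ
  · filter_upwards [eventually_ne_atTop 0] with n hn
    exact lt_of_lt_of_le (by positivity) (sum_gibbsWeight_ge N hn hβ le_rfl)
  · filter_upwards [eventually_sum_gibbsWeight_ge hN hβ one_pos] with n hn
    exact lt_of_lt_of_le (by positivity) hn

end Asymptotics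

end SpinSystem

namespace SpinSystem

open Filter Topology

theorem continuous_sinhc : Continuous sinhc := by
  have h : sinhc = dslope Complex.sinh 0 := by
    funext z
    by_cases hz : z = 0
    · subst hz; simp [sinhc]
    · rw [dslope_of_ne _ hz, slope_def_field]; simp [sinhc, hz]
  rw [h, ← continuousOn_univ, continuousOn_dslope univ_mem]
  exact ⟨Complex.continuous_sinh.continuousOn, Complex.differentiableAt_sinh⟩

theorem sinhc_zero : sinhc 0 = 1 := by simp [sinhc]

theorem sinhc_neg (z : ℂ) : sinhc (-z) = sinhc z := by
  unfold sinhc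
  simp only [neg_eq_zero, Complex.sinh_neg, neg_div_neg_eq]

theorem sinhc_mul_abs (h : ℂ) (s : ℝ) : sinhc (h * (|s| : ℝ)) = sinhc (h * s) := by
  rcases abs_choice s with hs | hs
  · rw [hs]
  · rw [hs, Complex.ofReal_neg, mul_neg, sinhc_neg]

theorem tendsto_gibbsWeight_average {N : ℕ} (hN : 1 ≤ N) (β : ℝ) (h : ℂ) :
    Tendsto (fun n : ℕ => (∑ t ∈ dims N n, (gibbsWeight N n (β / n) t : ℂ) *
      sinhc (h * ((t / (2 * n) : ℝ) : ℂ))) /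
        ((∑ t ∈ dims N n, gibbsWeight N n (β / n) t : ℝ) : ℂ)) atTop
      (𝓝 (sinhc (h * (mStar N β : ℂ)))) := by
  have hq : Continuous fun s : ℝ => sinhc (h * s) := continuous_sinhc.comp (by fun_prop)
  obtain ⟨B, hB⟩ :=
    (isCompact_Icc (a := -((N + 1) / 2 : ℝ)) (b := (N + 1) / 2)).exists_bound_of_continuousOn (f := fun s : ℝ => sinhc (h * s) - sinhc (h * (mStar N β : ℂ)))
    (hq.sub continuous_const).continuousOn
  have hB0 : 0 ≤ B := (norm_nonneg _).trans (hB 0 ⟨by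
    have : (0 : ℝ) ≤ (N + 1) / 2 := by positivity
    linarith, by positivity⟩)
  rw [Metric.tendsto_nhds]
  intro ε hε
  obtain ⟨δ, hδ, hδε⟩ := Metric.continuousAt_iff.1 (hq.continuousAt (x := mStar N β))
    (ε / 2) (half_pos hε)
  have ht := (tendsto_tail_mStar hN β hδ).const_mul B
  rw [mul_zero] at ht
  filter_upwards [ht.eventually (gt_mem_nhds (half_pos hε)), eventually_sum_gibbsWeight_pos hN β,
    eventually_ne_atTop 0] with n hn hZ hn0
  set Z := ∑ t ∈ dims N n, gibbsWeight N n (β / n) t with hZdef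
  have hZ' : (Z : ℂ) ≠ 0 := by exact_mod_cast hZ.ne'
  have e : (∑ t ∈ dims N n, (gibbsWeight N n (β / n) t : ℂ) *
      sinhc (h * ((t / (2 * n) : ℝ) : ℂ))) / (Z : ℂ) - sinhc (h * (mStar N β : ℂ)) =
      (∑ t ∈ dims N n, (gibbsWeight N n (β / n) t : ℂ) *
        (sinhc (h * ((t / (2 * n) : ℝ) : ℂ)) - sinhc (h * (mStar N β : ℂ)))) / (Z : ℂ) := by
    simp only [mul_sub, Finset.sum_sub_distrib, ← Finset.sum_mul]
    rw [sub_div, ← Complex.ofReal_sum, mul_div_cancel_left₀ _ hZ']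
  rw [dist_eq_norm, e, norm_div, Complex.norm_real, Real.norm_of_nonneg hZ.le, div_lt_iff₀ hZ]
  have hterm : ∀ t ∈ dims N n, ‖(gibbsWeight N n (β / n) t : ℂ) *
      (sinhc (h * ((t / (2 * n) : ℝ) : ℂ)) - sinhc (h * (mStar N β : ℂ)))‖ ≤
      ε / 2 * gibbsWeight N n (β / n) t +
        if δ ≤ |(|(t : ℝ) / (2 * n)| - mStar N β)| then B * gibbsWeight N n (β / n) t else 0 := by
    intro t ht
    have hw := gibbsWeight_nonneg N n (β / n) t
    rw [norm_mul, Complex.norm_real, Real.norm_of_nonneg hw]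
    split_ifs with hc
    · have := hB (t / (2 * n)) (abs_le.1 (abs_div_le_of_mem_dims N hn0 ht))
      nlinarith
    · rw [add_zero, mul_comm]
      refine mul_le_mul_of_nonneg_right ?_ hw
      rw [not_le, ← Real.dist_eq] at hc
      have := hδε hc
      rw [dist_eq_norm, sinhc_mul_abs] at this
      exact this.le
  refine (norm_sum_le_of_le _ hterm).trans_lt ?_
  rw [Finset.sum_add_distrib, ← Finset.mul_sum, ← Finset.sum_filter, ← Finset.mul_sum]
  change ε / 2 * Z + B * ∑ t ∈ awayFrom N n (mStar N β) δ, gibbsWeight N n (β / n) t < ε * Z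
  rw [mul_div_assoc', div_lt_iff₀ hZ] at hn
  linarith

theorem tendsto_gibbs {N : ℕ} (hN : 1 ≤ N) (β : ℝ) (h : ℂ) :
    Tendsto (fun n : ℕ => gibbs N n β 1 (NormedSpace.exp ((h / (n : ℂ)) •
      ∑ i : Fin n, atSite (spin1 N) i))) atTop (𝓝 (sinhc (h * (mStar N β : ℂ)))) := by
  have hz : Tendsto (fun n : ℕ => sinhc (h / (n : ℂ) / 2)) atTop (𝓝 1) := by
    have h1 : Tendsto (fun n : ℕ => h / (n : ℂ) / 2) atTop (𝓝 0) := by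
      have := (tendsto_const_div_atTop_nhds_zero_nat h).div_const 2
      rwa [zero_div] at this
    have := (continuous_sinhc.tendsto 0).comp h1
    rwa [sinhc_zero] at this
  have hlim := (tendsto_gibbsWeight_average hN β h).div hz one_ne_zero
  rw [div_one] at hlim
  refine hlim.congr' ?_
  filter_upwards [hz.eventually_ne one_ne_zero, eventually_ne_atTop 0] with n hn hn0
  rw [gibbs_exp_total_spin1 N n hn0, Pi.div_apply, trace_exp_casimir, div_right_comm]
  congr 1
  rw [div_eq_iff hn, mul_comm (Matrix.trace _), sinhc_mul_trace_exp]
  refine Finset.sum_congr rfl fun t _ => ?_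
  congr 2
  push_cast
  have : (n : ℂ) ≠ 0 := by exact_mod_cast hn0
  field_simp

end SpinSystem

end

theorem theorem2p1 (N : ℕ) (hN : 1 ≤ N) (β : ℝ) :
    (∀ m ∈ Set.Ioo (-SpinSystem.spin N) (SpinSystem.spin N),
      ∃! x : ℝ, HasDerivAt (SpinSystem.eta N) m x) ∧
    (∃! m : ℝ, SpinSystem.IsMaximiser N β m) ∧
    (0 < SpinSystem.mStar N β ↔ SpinSystem.betaC N < β) ∧
    ∀ h : ℂ, Filter.Tendsto
      (fun n : ℕ => SpinSystem.gibbs N n β 1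
        (NormedSpace.exp ((h / (n : ℂ)) •
          ∑ i : Fin n, SpinSystem.atSite (SpinSystem.spin1 N) i)))
      Filter.atTop (nhds (SpinSystem.sinhc (h * (SpinSystem.mStar N β : ℂ)))) :=
  ⟨fun _ hm => SpinSystem.existsUnique_hasDerivAt_eta hN hm,
    SpinSystem.existsUnique_isMaximiser hN β, SpinSystem.mStar_pos_iff hN β,
    SpinSystem.tendsto_gibbs hN β⟩
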